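/- **Theorem (Complete eigenvector delocalization).** There is a universal constant $C_*\ge 1$ such that the following holds. Let $D>0$ and put $$C(D)=\bigl(4C_*e^{5+D}\bigr)^2,\qquad N_0(D)=\exp\Bigl[\bigl(e^{10}\log(4C_*e^{5+D})\bigr)^2\Bigr].$$ Let $N\ge N_0(D)$ be an integer and let $q\in(0,N^{1/2})$ satisfy $C(D)\sqrt{\log N}\le q\le(\log N)^{10}$. Let $H=(H_{ij})$ be a random real symmetric $N\times N$ matrix such that (i) the entries $(H_{ij}: 1\le i\le j\le N)$ are independent; (ii) $\mathbb E H_{ij}=0$ for all $i,j$, $\mathbb E H_{ij}^2=1/N$ for $i\ne j$, and $|\mathbb E H_{ii}^2-1/N|\le K/N$ for all $i$, where $K$ is some constant; (iii) $\mathbb E|H_{ij}|^k\le 1/(Nq^{k-2})$ for all $i,j$ and all integers $k\ge 3$. Let $0\le f\le q$ and $A = H + f\,\mathbf e\mathbf e^*$, where $\mathbf e = N^{-1/2}(1,\dots,1)^*$. Then $$\mathbb P\Bigl(\text{there is an eigenvector } \mathbf u \text{ of } A \text{ with } \|\mathbf u\|_2=1 \text{ and } \|\mathbf u\|_\infty\ge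 N^{(\log N)^{-1/2}-1/2}\Bigr)\le N^{-D}.$$ The constant $C_*$ does not depend on $D$, $N$, $q$, $f$, $K$ or the law of $H$. -/

import Mathlib

open MeasureTheory ProbabilityTheory

/-- A sparse random matrix with sparsity parameter `q ∈ (0, √N)`: a random real symmetric `N × N`
matrix `H` with independent upper-triangular entries (diagonal included) such that `E H i j = 0`,
`E (H i j)² = (1 + O(δ i j)) / N` and `E |H i j| ^ k ≤ 1 / (N q ^ (k - 2))` for every `k ≥ 3`.
The number `K` is the constant hidden in the `O`, so it concerns the diagonal entries only. -/
structure IsSparseMatrix {Ω : Type*} [MeasurableSpace Ω] (μ : Measure Ω) {N : ℕ} (q K : ℝ)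
    (H : Ω → Matrix (Fin N) (Fin N) ℝ) : Prop where
  q_pos : 0 < q
  q_lt : q < √(N : ℝ)
  measurable : ∀ i j, Measurable fun ω => H ω i j
  symm : ∀ ω, (H ω).IsSymm
  indep : iIndepFun
    (fun (e : {e : Fin N × Fin N // e.1 ≤ e.2}) (ω : Ω) => H ω e.1.1 e.1.2) μ
  integrable : ∀ (k : ℕ) (i j : Fin N), Integrable (fun ω => |H ω i j| ^ k) μ
  mean : ∀ i j, ∫ ω, H ω i j ∂μ = 0
  variance_offDiag : ∀ i j, i ≠ j → ∫ ω, H ω i j ^ 2 ∂μ = 1 / (N : ℝ)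
  variance_diag : ∀ i, |∫ ω, H ω i i ^ 2 ∂μ - 1 / (N : ℝ)| ≤ K / (N : ℝ)
  moment : ∀ k : ℕ, 3 ≤ k → ∀ i j, ∫ ω, |H ω i j| ^ k ∂μ ≤ 1 / ((N : ℝ) * q ^ (k - 2))

/-- The vector `e = N ^ (-1/2) (1, …, 1)`. -/
noncomputable def flatVector (N : ℕ) : Fin N → ℝ := fun _ => (N : ℝ) ^ (-(1 / 2) : ℝ)

/-- The matrix `A = H + f e eᵀ`. -/
noncomputable def adjacencyMatrix {N : ℕ} (f : ℝ) (H : Matrix (Fin N) (Fin N) ℝ) :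
    Matrix (Fin N) (Fin N) ℝ :=
  H + f • Matrix.vecMulVec (flatVector N) (flatVector N)

/-- `u` is a normalized eigenvector of `A`: an eigenvector, for some eigenvalue, of Euclidean
norm one. -/
def IsNormalizedEigenvector {N : ℕ} (A : Matrix (Fin N) (Fin N) ℝ)
    (u : EuclideanSpace ℝ (Fin N)) : Prop :=
  ‖u‖ = 1 ∧ ∃ l : ℝ, Module.End.HasEigenvector (Matrix.toEuclideanLin A) l u

/-- The norm `max_k |u k|` (the norm of `Fin N → ℝ` is the maximum norm). -/
noncomputable def supNorm {N : ℕ} (u : EuclideanSpace ℝ (Fin N)) : ℝ :=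
  ‖(WithLp.ofLp u : Fin N → ℝ)‖

/-- `C(δ, D) = (4 C_* e ^ (5 + D) / δ) ^ 2`. -/
noncomputable def sparsityConstant (Cstar δ D : ℝ) : ℝ :=
  (4 * Cstar * Real.exp (5 + D) / δ) ^ 2

/-- `N₀(δ, D) = exp ((e ^ 10 log (4 C_* e ^ (5 + D) / δ)) ^ 2)`. -/
noncomputable def sizeThreshold (Cstar δ D : ℝ) : ℝ :=
  Real.exp ((Real.exp 10 * Real.log (4 * Cstar * Real.exp (5 + D) / δ)) ^ 2)

/-! Delocalization follows from boundedness of the Green function `G = (A - z)⁻¹` just above the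
scale `1 / N`; no local semicircle law is needed. If `A u = l u` with `u` normalized, then `u = (l -
z) G u`, and Cauchy–Schwarz with the Ward identity gives `u_k² ≤ |l - z|² |G_kk| / Im z`. Put `ℓ =
√(log N)` and `η = e^ℓ / N`. For `z = E + iη` with `|l - E| ≤ η`, a bound `|G_kk| ≤ 42` gives `u_k²
≤ 84 η`, which is below `e^(2ℓ) / N`, the square of the claimed size (`eigenvector_sq_le`,
`supNorm_lt_of_concentrated`).

The bound on `G` descends from `η ≥ 2`, where it is trivial, by halving `η`. Halving at most doubles
the bound (`norm_greenFunction_half_le`), and a self-consistent equation restores it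
(`greenBounded_step`). By the Schur complement formula, `1 / G_ii` is `A_ii - z` minus a quadratic
form in row `i` with the Green function of the minor as kernel. If that form is close to the
normalized trace, then `G_ii (z + s) ≈ -1` with `s = N⁻¹ tr G`; averaging over `i` gives `s (z + s)
≈ -1`, so `z + s` cannot be small and `G_ii` is bounded by an absolute constant. Energies `|E| > 10`
are handled separately, since there `|z|` alone dominates `s`.

The probabilistic input is concentration of that quadratic form. Row `i` is independent of the
minor, which may therefore be frozen; by Ward, the frozen kernel has row sums of squares at most
`100 N e^(-ℓ)`. The moment hypotheses force `|H_ij| ≤ 1 / q` almost surely, hence a Poisson-type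
exponential moment bound. The off-diagonal part of the form is a martingale, controlled by an
exponential supermartingale (`lintegral_exp_compensated_le`, `measure_abs_chaos_ge_le`), and its
quadratic variation is controlled by the same tools. Since `q` is polylogarithmic in `N`, all powers
of `q` and `ℓ` are absorbed by `e^(-ℓ/4)`. The same smallness bounds the row sums of the kernel, so
the shift `f / N` of the entries is treated directly.

Each row fails with probability at most `32 N e^(-K)` with `K = (D + 10) log N`. A union bound over
a grid of energies of mesh `1 / N`, over `N` scales and over `N` rows concludes. -/

/-! ### Green functions of real symmetric matrices -/

section Green

variable {ι : Type*} [Fintype ι] [DecidableEq ι]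

/-- The matrix `A - z`. -/
noncomputable def spectralShift (A : Matrix ι ι ℝ) (z : ℂ) : Matrix ι ι ℂ :=
  A.map Complex.ofReal - z • (1 : Matrix ι ι ℂ)

/-- The Green function `(A - z)⁻¹`. -/
noncomputable def greenFunction (A : Matrix ι ι ℝ) (z : ℂ) : Matrix ι ι ℂ :=
  (spectralShift A z)⁻¹

/-- A kernel vector `v` satisfies `z ‖v‖² = ⟨v, A v⟩`, which is real; taking imaginary parts forces
`v = 0`. -/
theorem spectralShift_det_ne_zero {A : Matrix ι ι ℝ} (hA : A.IsSymm) {z : ℂ} (hz : 0 < z.im) :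
    (spectralShift A z).det ≠ 0 := by
  intro hdet
  obtain ⟨v, hv, h⟩ := Matrix.exists_mulVec_eq_zero_iff.mpr hdet
  have hH : (A.map Complex.ofReal).IsHermitian := by
    ext i j
    simp [Matrix.conjTranspose_apply, hA.apply i j]
  have him := hH.im_star_dotProduct_mulVec_self v
  have h1 : (A.map Complex.ofReal).mulVec v = z • v := by
    have : (A.map Complex.ofReal).mulVec v - z • v = 0 := by
      rw [← h, spectralShift, Matrix.sub_mulVec, Matrix.smul_mulVec, Matrix.one_mulVec]
    exact sub_eq_zero.mp this
  rw [h1, dotProduct_smul] at him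
  have h2 : star v ⬝ᵥ v = ((∑ i, ‖v i‖ ^ 2 : ℝ) : ℂ) := by
    simp only [dotProduct, Pi.star_apply, RCLike.star_def, Complex.ofReal_sum]
    exact Finset.sum_congr rfl fun i _ => by
      rw [mul_comm, Complex.mul_conj, Complex.normSq_eq_norm_sq]
  rw [h2] at him
  have h3 : z.im * ∑ i, ‖v i‖ ^ 2 = 0 := by
    rw [smul_eq_mul, RCLike.im_to_complex, Complex.im_mul_ofReal] at him
    exact him
  have h4 : ∑ i, ‖v i‖ ^ 2 = 0 := (mul_eq_zero.mp h3).resolve_left hz.ne'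
  refine hv (funext fun i => ?_)
  have := (Finset.sum_eq_zero_iff_of_nonneg (fun i _ => sq_nonneg ‖v i‖)).mp h4 i (Finset.mem_univ i)
  simpa using this

theorem spectralShift_mul_greenFunction {A : Matrix ι ι ℝ} (hA : A.IsSymm) {z : ℂ}
    (hz : 0 < z.im) : spectralShift A z * greenFunction A z = 1 :=
  Matrix.mul_nonsing_inv _ (isUnit_iff_ne_zero.mpr (spectralShift_det_ne_zero hA hz))

theorem greenFunction_mul_spectralShift {A : Matrix ι ι ℝ} (hA : A.IsSymm) {z : ℂ}
    (hz : 0 < z.im) : greenFunction A z * spectralShift A z = 1 :=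
  Matrix.nonsing_inv_mul _ (isUnit_iff_ne_zero.mpr (spectralShift_det_ne_zero hA hz))

omit [Fintype ι] in
theorem spectralShift_transpose {A : Matrix ι ι ℝ} (hA : A.IsSymm) (z : ℂ) :
    (spectralShift A z).transpose = spectralShift A z := by
  ext i j
  simp [spectralShift, hA.apply i j, Matrix.one_apply, eq_comm]

theorem greenFunction_comm {A : Matrix ι ι ℝ} (hA : A.IsSymm) (z : ℂ) (i j : ι) :
    greenFunction A z i j = greenFunction A z j i := by
  have : (greenFunction A z).transpose = greenFunction A z := by
    rw [greenFunction, Matrix.transpose_nonsing_inv, spectralShift_transpose hA]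
  conv_lhs => rw [← this]
  rfl

/-- The Ward identity. -/
theorem greenFunction_ward {A : Matrix ι ι ℝ} (hA : A.IsSymm) {z : ℂ} (hz : 0 < z.im) (j : ι) :
    ∑ k, ‖greenFunction A z j k‖ ^ 2 = (greenFunction A z j j).im / z.im := by
  set G := greenFunction A z with hG
  set M := spectralShift A z with hM
  have hMG : M * G = 1 := spectralShift_mul_greenFunction hA hz
  have hGM : G * M = 1 := greenFunction_mul_spectralShift hA hz
  have hdiff : M.conjTranspose = M + (z - starRingEnd ℂ z) • (1 : Matrix ι ι ℂ) := by
    ext i k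
    by_cases h : i = k
    · subst h; simp [hM, spectralShift]
    · simp [hM, spectralShift, h, Ne.symm h, hA.apply i k]
  have h2 : G.conjTranspose * M.conjTranspose = 1 := by
    rw [← Matrix.conjTranspose_mul, hMG, Matrix.conjTranspose_one]
  have h3 : M.conjTranspose * G.conjTranspose = 1 := by
    rw [← Matrix.conjTranspose_mul, hGM, Matrix.conjTranspose_one]
  -- Resolvent identity between `z` and its conjugate; the imaginary part of a diagonal entry is the
  -- Ward identity.
  have h4 : G - G.conjTranspose = (z - starRingEnd ℂ z) • (G * G.conjTranspose) := by
    calc G - G.conjTranspose = G * (M.conjTranspose * G.conjTranspose)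
          - (G * M) * G.conjTranspose := by rw [h3, hGM, mul_one, one_mul]
      _ = G * (M.conjTranspose - M) * G.conjTranspose := by
          simp only [mul_sub, sub_mul, mul_assoc]
      _ = _ := by rw [hdiff, add_sub_cancel_left]; simp
  have h5 := congrArg Complex.im (congrFun (congrFun h4 j) j)
  have h6 : (G * G.conjTranspose) j j = ((∑ k, ‖G j k‖ ^ 2 : ℝ) : ℂ) := by
    simp only [Matrix.mul_apply, Matrix.conjTranspose_apply, RCLike.star_def, Complex.ofReal_sum]
    exact Finset.sum_congr rfl fun i _ => by
      rw [Complex.mul_conj, Complex.normSq_eq_norm_sq]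
  rw [Matrix.smul_apply, h6] at h5
  simp only [Matrix.sub_apply, Matrix.conjTranspose_apply, RCLike.star_def, Complex.sub_im,
    Complex.conj_im, smul_eq_mul, Complex.mul_im, Complex.ofReal_im, Complex.ofReal_re,
    mul_zero, zero_add] at h5
  rw [eq_div_iff hz.ne']
  linarith

theorem norm_greenFunction_diag_le {A : Matrix ι ι ℝ} (hA : A.IsSymm) {z : ℂ} (hz : 0 < z.im)
    (j : ι) : ‖greenFunction A z j j‖ ≤ 1 / z.im := by
  have h := greenFunction_ward hA hz j
  have h1 : ‖greenFunction A z j j‖ ^ 2 ≤ ∑ k, ‖greenFunction A z j k‖ ^ 2 :=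
    Finset.single_le_sum (f := fun k => ‖greenFunction A z j k‖ ^ 2)
      (fun k _ => sq_nonneg _) (Finset.mem_univ j)
  have h2 : (greenFunction A z j j).im ≤ ‖greenFunction A z j j‖ := Complex.im_le_norm _
  have h3 : ‖greenFunction A z j j‖ ^ 2 ≤ ‖greenFunction A z j j‖ * (1 / z.im) := by
    rw [h] at h1
    refine h1.trans ?_
    rw [mul_one_div]
    gcongr
  rcases (norm_nonneg (greenFunction A z j j)).eq_or_lt with h0 | h0
  · rw [← h0]; positivity
  · rw [sq] at h3
    exact le_of_mul_le_mul_left h3 h0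

theorem sum_norm_sq_greenFunction_le {A : Matrix ι ι ℝ} (hA : A.IsSymm) {z : ℂ} (hz : 0 < z.im)
    (j : ι) : ∑ k, ‖greenFunction A z j k‖ ^ 2 ≤ ‖greenFunction A z j j‖ / z.im := by
  rw [greenFunction_ward hA hz j]
  gcongr
  exact Complex.im_le_norm _

theorem norm_greenFunction_le {A : Matrix ι ι ℝ} (hA : A.IsSymm) {z : ℂ} (hz : 0 < z.im)
    (j k : ι) : ‖greenFunction A z j k‖ ≤ 1 / z.im := by
  refine abs_le_of_sq_le_sq' ?_ (by positivity) |>.2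
  calc ‖greenFunction A z j k‖ ^ 2 ≤ ∑ k, ‖greenFunction A z j k‖ ^ 2 :=
        Finset.single_le_sum (f := fun k => ‖greenFunction A z j k‖ ^ 2)
          (fun k _ => sq_nonneg _) (Finset.mem_univ k)
    _ ≤ ‖greenFunction A z j j‖ / z.im := sum_norm_sq_greenFunction_le hA hz j
    _ ≤ (1 / z.im) / z.im := by gcongr; exact norm_greenFunction_diag_le hA hz j
    _ = (1 / z.im) ^ 2 := by field_simp

/-- An eigenvector entry is controlled by the diagonal of the Green function. -/
theorem eigenvector_sq_le {A : Matrix ι ι ℝ} (hA : A.IsSymm) {z : ℂ} (hz : 0 < z.im)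
    {u : ι → ℝ} (hu : ∑ i, u i ^ 2 = 1) {l : ℝ} (hl : A.mulVec u = l • u) (k : ι) :
    u k ^ 2 ≤ ‖(l : ℂ) - z‖ ^ 2 * (‖greenFunction A z k k‖ / z.im) := by
  set G := greenFunction A z with hG
  have hMG : spectralShift A z * G = 1 := spectralShift_mul_greenFunction hA hz
  have h1 : Matrix.vecMul (fun i => (u i : ℂ)) (spectralShift A z)
      = ((l : ℂ) - z) • fun i => (u i : ℂ) := by
    rw [← Matrix.mulVec_transpose, spectralShift_transpose hA, spectralShift, Matrix.sub_mulVec,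
      Matrix.smul_mulVec, Matrix.one_mulVec, sub_smul]
    congr 1
    ext i
    have := congrFun hl i
    simp only [Matrix.mulVec, dotProduct, Pi.smul_apply, smul_eq_mul, Matrix.map_apply] at this ⊢
    exact_mod_cast this
  -- Multiply `uᵀ (A - z) = (l - z) uᵀ` by `G` on the right.
  have h2 : (u k : ℂ) = ((l : ℂ) - z) * ∑ i, (u i : ℂ) * G i k := by
    have := congrFun (congrArg (fun v => Matrix.vecMul v G) h1) k
    simp only [Matrix.vecMul_vecMul, hMG, Matrix.vecMul_one, Matrix.smul_vecMul] at this
    simpa [Matrix.vecMul, dotProduct] using this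
  have h3 : ‖∑ i, (u i : ℂ) * G i k‖ ^ 2 ≤ ∑ i, ‖G k i‖ ^ 2 := by
    calc ‖∑ i, (u i : ℂ) * G i k‖ ^ 2 ≤ (∑ i, |u i| * ‖G k i‖) ^ 2 := by
          gcongr
          refine (norm_sum_le _ _).trans (le_of_eq (Finset.sum_congr rfl fun i _ => ?_))
          rw [norm_mul, Complex.norm_real, Real.norm_eq_abs, hG, greenFunction_comm hA]
      _ ≤ (∑ i, |u i| ^ 2) * ∑ i, ‖G k i‖ ^ 2 := Finset.sum_mul_sq_le_sq_mul_sq _ _ _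
      _ = _ := by simp [hu]
  calc u k ^ 2 = ‖(u k : ℂ)‖ ^ 2 := by simp
    _ = ‖(l : ℂ) - z‖ ^ 2 * ‖∑ i, (u i : ℂ) * G i k‖ ^ 2 := by rw [h2, norm_mul, mul_pow]
    _ ≤ _ := by
      gcongr
      exact h3.trans (sum_norm_sq_greenFunction_le hA hz k)

theorem greenFunction_sub {A : Matrix ι ι ℝ} (hA : A.IsSymm) {z w : ℂ} (hz : 0 < z.im)
    (hw : 0 < w.im) :
    greenFunction A z - greenFunction A w
      = (z - w) • (greenFunction A z * greenFunction A w) := by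
  have h1 : spectralShift A w - spectralShift A z = (z - w) • (1 : Matrix ι ι ℂ) := by
    rw [spectralShift, spectralShift, sub_smul]; abel
  calc greenFunction A z - greenFunction A w
      = greenFunction A z * (spectralShift A w * greenFunction A w)
        - (greenFunction A z * spectralShift A z) * greenFunction A w := by
        rw [spectralShift_mul_greenFunction hA hw, greenFunction_mul_spectralShift hA hz,
          mul_one, one_mul]
    _ = greenFunction A z * (spectralShift A w - spectralShift A z) * greenFunction A w := by
        simp only [mul_sub, sub_mul, mul_assoc]
    _ = _ := by rw [h1]; simp

/-- Halving the imaginary part at most doubles the size of the Green function. -/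
theorem norm_greenFunction_half_le {A : Matrix ι ι ℝ} (hA : A.IsSymm) {E η B : ℝ} (hη : 0 < η)
    (hB : ∀ j k, ‖greenFunction A ⟨E, 2 * η⟩ j k‖ ≤ B) (j k : ι) :
    ‖greenFunction A ⟨E, η⟩ j k‖ ≤ 2 * B := by
  set G := greenFunction A ⟨E, η⟩ with hG
  set G' := greenFunction A ⟨E, 2 * η⟩ with hG'
  -- Working at the largest entry `g` lets Ward bound the row of `G` by `g` itself.
  obtain ⟨p, -, hp⟩ := Finset.exists_max_image (Finset.univ : Finset (ι × ι))
    (fun p => ‖G p.1 p.2‖) ⟨(j, k), Finset.mem_univ _⟩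
  set g := ‖G p.1 p.2‖ with hg
  have hle : ∀ a b, ‖G a b‖ ≤ g := fun a b => hp (a, b) (Finset.mem_univ _)
  have hg0 : 0 ≤ g := norm_nonneg _
  have hB0 : 0 ≤ B := (norm_nonneg _).trans (hB j k)
  have hsub := greenFunction_sub hA (z := ⟨E, η⟩) (w := ⟨E, 2 * η⟩) hη (by simpa using hη)
  rw [← hG, ← hG'] at hsub
  have hnz : ‖((⟨E, η⟩ : ℂ) - ⟨E, 2 * η⟩)‖ = η := by
    have : ((⟨E, η⟩ : ℂ) - ⟨E, 2 * η⟩) = ((-η : ℝ) : ℂ) * Complex.I := by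
      apply Complex.ext <;> simp; ring
    rw [this]; simp [abs_of_pos hη]
  have key : g ≤ B + η * (∑ i, ‖G p.1 i‖ * ‖G' p.2 i‖) := by
    have h1 : G p.1 p.2 = G' p.1 p.2 + ((⟨E, η⟩ : ℂ) - ⟨E, 2 * η⟩) * (G * G') p.1 p.2 := by
      have := congrFun (congrFun hsub p.1) p.2
      simp only [Matrix.sub_apply, Matrix.smul_apply, smul_eq_mul] at this
      rw [← this]; ring
    rw [hg, h1]
    refine (norm_add_le _ _).trans (add_le_add (hB _ _) ?_)
    rw [norm_mul, hnz, Matrix.mul_apply]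
    gcongr
    refine (norm_sum_le _ _).trans (le_of_eq (Finset.sum_congr rfl fun i _ => ?_))
    rw [norm_mul, hG', greenFunction_comm hA]
  -- The weights are chosen so that `g ≤ B + g/4 + B/2`, which is exactly `g ≤ 2B`.
  have hamgm : ∑ i, ‖G p.1 i‖ * ‖G' p.2 i‖ ≤
      ∑ i, (‖G p.1 i‖ ^ 2 / 4 + ‖G' p.2 i‖ ^ 2) := by
    gcongr with i _
    nlinarith [sq_nonneg (‖G p.1 i‖ / 2 - ‖G' p.2 i‖)]
  rw [Finset.sum_add_distrib, ← Finset.sum_div] at hamgm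
  have w1 : ∑ i, ‖G p.1 i‖ ^ 2 ≤ g / η :=
    (sum_norm_sq_greenFunction_le hA (z := ⟨E, η⟩) hη _).trans (by gcongr; exact hle _ _)
  have w2 : ∑ i, ‖G' p.2 i‖ ^ 2 ≤ B / (2 * η) :=
    (sum_norm_sq_greenFunction_le hA (z := ⟨E, 2 * η⟩) (by simpa using hη) _).trans
      (by gcongr; exact hB _ _)
  have h5 : η * (∑ i, ‖G p.1 i‖ * ‖G' p.2 i‖) ≤ g / 4 + B / 2 := by
    calc η * (∑ i, ‖G p.1 i‖ * ‖G' p.2 i‖) ≤ η * ((g / η) / 4 + B / (2 * η)) := by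
          gcongr; linarith
      _ = g / 4 + B / 2 := by field_simp
  have := hle j k
  linarith

/-! #### Schur complement -/

/-- The matrix with row and column `i` removed. -/
def minor (A : Matrix ι ι ℝ) (i : ι) : Matrix {j // j ≠ i} {j // j ≠ i} ℝ :=
  A.submatrix (↑) (↑)

omit [Fintype ι] [DecidableEq ι] in
theorem minor_isSymm {A : Matrix ι ι ℝ} (hA : A.IsSymm) (i : ι) : (minor A i).IsSymm :=
  hA.submatrix _

/-- The vector `(G⁽ⁱ⁾ a)_k`, where `a` is row `i` without its diagonal entry. -/
noncomputable def minorRow (A : Matrix ι ι ℝ) (z : ℂ) (i : ι) (k : {j // j ≠ i}) : ℂ :=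
  ∑ j : {j // j ≠ i}, (A i j : ℂ) * greenFunction (minor A i) z j k

omit [Fintype ι] in
theorem spectralShift_minor (A : Matrix ι ι ℝ) (z : ℂ) (i : ι) (j k : {j // j ≠ i}) :
    spectralShift (minor A i) z j k = spectralShift A z j k := by
  simp [spectralShift, minor, Matrix.one_apply, Subtype.ext_iff]

/-- Row `j` of `G (A - z) = 1`, read on the columns other than `i`, is multiplied on the right by
the Green function of the minor. -/
theorem greenFunction_eq_minor {A : Matrix ι ι ℝ} (hA : A.IsSymm) {z : ℂ} (hz : 0 < z.im)
    (i : ι) (j k : {j // j ≠ i}) :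
    greenFunction A z j k
      = greenFunction (minor A i) z j k - greenFunction A z j i * minorRow A z i k := by
  set G := greenFunction A z
  set G0 := greenFunction (minor A i) z
  have hM : ∀ m : {j // j ≠ i}, ∑ l : {j // j ≠ i}, G j l * spectralShift A z l m
      = (1 : Matrix {j // j ≠ i} {j // j ≠ i} ℂ) j m - G j i * (A i m : ℂ) := by
    intro m
    have := congrFun (congrFun (greenFunction_mul_spectralShift hA hz) (j : ι)) (m : ι)
    rw [Matrix.mul_apply, Fintype.sum_eq_add_sum_subtype_ne _ i] at this
    have h1 : spectralShift A z i m = (A i m : ℂ) := by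
      simp [spectralShift, m.2.symm]
    rw [h1] at this
    rw [eq_sub_iff_add_eq, add_comm, this]
    simp [Matrix.one_apply, Subtype.ext_iff]
  have h0 : ∀ l : {j // j ≠ i},
      ∑ m : {j // j ≠ i}, spectralShift A z l m * G0 m k
        = (1 : Matrix {j // j ≠ i} {j // j ≠ i} ℂ) l k := by
    intro l
    have := congrFun (congrFun (spectralShift_mul_greenFunction (minor_isSymm hA i) hz) l) k
    rw [Matrix.mul_apply] at this
    rw [← this]
    exact Finset.sum_congr rfl fun m _ => by rw [spectralShift_minor]
  calc G j k = ∑ l : {j // j ≠ i}, G j l * (1 : Matrix {j // j ≠ i} {j // j ≠ i} ℂ) l k := by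
        simp [Matrix.one_apply]
    _ = ∑ m : {j // j ≠ i}, (∑ l : {j // j ≠ i}, G j l * spectralShift A z l m) * G0 m k := by
        simp_rw [← h0, Finset.mul_sum, Finset.sum_mul, mul_assoc]
        exact Finset.sum_comm
    _ = _ := by
        simp_rw [hM, sub_mul, Finset.sum_sub_distrib, minorRow, Finset.mul_sum, mul_assoc]
        simp [Matrix.one_apply]
        rfl

/-- The same computation for row `i`, where the identity matrix contributes nothing. -/
theorem greenFunction_row_eq {A : Matrix ι ι ℝ} (hA : A.IsSymm) {z : ℂ} (hz : 0 < z.im)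
    (i : ι) (k : {j // j ≠ i}) :
    greenFunction A z i k = -greenFunction A z i i * minorRow A z i k := by
  set G := greenFunction A z
  set G0 := greenFunction (minor A i) z
  have hM : ∀ m : {j // j ≠ i}, ∑ l : {j // j ≠ i}, G i l * spectralShift A z l m
      = - G i i * (A i m : ℂ) := by
    intro m
    have := congrFun (congrFun (greenFunction_mul_spectralShift hA hz) i) (m : ι)
    rw [Matrix.mul_apply, Fintype.sum_eq_add_sum_subtype_ne _ i] at this
    have h1 : spectralShift A z i m = (A i m : ℂ) := by
      simp [spectralShift, m.2.symm]
    rw [h1, Matrix.one_apply_ne m.2.symm] at this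
    rw [neg_mul, ← add_eq_zero_iff_eq_neg, add_comm, this]
  have h0 : ∀ l : {j // j ≠ i},
      ∑ m : {j // j ≠ i}, spectralShift A z l m * G0 m k
        = (1 : Matrix {j // j ≠ i} {j // j ≠ i} ℂ) l k := by
    intro l
    have := congrFun (congrFun (spectralShift_mul_greenFunction (minor_isSymm hA i) hz) l) k
    rw [Matrix.mul_apply] at this
    rw [← this]
    exact Finset.sum_congr rfl fun m _ => by rw [spectralShift_minor]
  calc G i k = ∑ l : {j // j ≠ i}, G i l * (1 : Matrix {j // j ≠ i} {j // j ≠ i} ℂ) l k := by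
        simp [Matrix.one_apply]
    _ = ∑ m : {j // j ≠ i}, (∑ l : {j // j ≠ i}, G i l * spectralShift A z l m) * G0 m k := by
        simp_rw [← h0, Finset.mul_sum, Finset.sum_mul, mul_assoc]
        exact Finset.sum_comm
    _ = _ := by
        simp_rw [hM, minorRow, Finset.mul_sum, mul_assoc]
        rfl

theorem greenFunction_schur {A : Matrix ι ι ℝ} (hA : A.IsSymm) {z : ℂ} (hz : 0 < z.im) (i : ι) :
    greenFunction A z i i
      * ((A i i : ℂ) - z - ∑ k : {j // j ≠ i}, minorRow A z i k * (A i k : ℂ)) = 1 := by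
  have := congrFun (congrFun (greenFunction_mul_spectralShift hA hz) i) i
  rw [Matrix.mul_apply, Fintype.sum_eq_add_sum_subtype_ne _ i, Matrix.one_apply_eq] at this
  rw [← this, mul_sub, Finset.mul_sum, sub_eq_add_neg, ← Finset.sum_neg_distrib]
  congr 1
  · simp [spectralShift]
  · refine Finset.sum_congr rfl fun k _ => ?_
    have h1 : spectralShift A z k i = (A i k : ℂ) := by
      simp [spectralShift, k.2, hA.apply i k]
    rw [h1, greenFunction_row_eq hA hz]
    ring

/-- Removing a row and a column changes the trace of the Green function little. -/
theorem greenFunction_trace_sub {A : Matrix ι ι ℝ} (hA : A.IsSymm) {z : ℂ} (hz : 0 < z.im)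
    (i : ι) :
    ∑ j, greenFunction A z j j - ∑ j, greenFunction (minor A i) z j j
      = greenFunction A z i i * (1 + ∑ j, minorRow A z i j ^ 2) := by
  rw [Fintype.sum_eq_add_sum_subtype_ne _ i, add_sub_assoc, ← Finset.sum_sub_distrib, mul_add,
    mul_one, Finset.mul_sum]
  congr 1
  refine Finset.sum_congr rfl fun j _ => ?_
  rw [greenFunction_eq_minor hA hz, greenFunction_comm hA, greenFunction_row_eq hA hz]
  ring

end Green

/-! ### Self-consistent equation and induction on scales. -/

section Bootstrap

variable {ι : Type*} [Fintype ι] [DecidableEq ι]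

/-- The hypotheses on row `i` of `A` under which the Schur complement formula closes. -/
def RowConcentrated (A : Matrix ι ι ℝ) (z : ℂ) (i : ι) (ε : ℝ) : Prop :=
  ‖∑ k : {j // j ≠ i}, minorRow A z i k * (A i k : ℂ)
      - (1 / (Fintype.card ι : ℂ)) * ∑ j, greenFunction (minor A i) z j j‖ ≤ ε ∧
    ∀ k, ‖minorRow A z i k‖ ≤ ε

/-- In the Schur formula three errors are collected: the diagonal entry, the fluctuation of the
quadratic form, and the change of the normalized trace when row `i` is removed. The last is `G_ii (1
+ ∑ minorRow²) / N`, small thanks to the a priori bound `84 = 2 · 42` left by halving the scale. -/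
theorem norm_self_consistent_le {A : Matrix ι ι ℝ} (hA : A.IsSymm) {z : ℂ} (hz : 0 < z.im)
    (hN : 10 ^ 6 ≤ Fintype.card ι) (i : ι) (hB : ‖greenFunction A z i i‖ ≤ 84)
    (hd : |A i i| ≤ 1 / 10 ^ 5) (hrow : RowConcentrated A z i (1 / 10 ^ 5)) :
    ‖greenFunction A z i i * (z + (1 / (Fintype.card ι : ℂ)) * ∑ j, greenFunction A z j j) + 1‖
      ≤ ‖greenFunction A z i i‖ * (1 / 5000) := by
  set N : ℂ := (Fintype.card ι : ℂ) with hNdef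
  have hNr : (10 : ℝ) ^ 6 ≤ (Fintype.card ι : ℝ) := by exact_mod_cast hN
  have hNn : ‖N‖ = (Fintype.card ι : ℝ) := by simp [hNdef]
  obtain ⟨h1, h2⟩ := hrow
  set S := ∑ k : {j // j ≠ i}, minorRow A z i k * (A i k : ℂ) with hS
  set t := ∑ j, greenFunction A z j j with ht
  set t0 := ∑ j, greenFunction (minor A i) z j j with ht0
  have hschur := greenFunction_schur hA hz i
  have htr : t - t0 = _ := greenFunction_trace_sub hA hz i
  rw [← hS] at hschur
  have hsum : ‖∑ j, minorRow A z i j ^ 2‖ ≤ (Fintype.card ι : ℝ) * (1 / 10 ^ 10) := by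
    calc ‖∑ j, minorRow A z i j ^ 2‖ ≤ ∑ j : {j // j ≠ i}, (1 / 10 ^ 10 : ℝ) := by
          refine norm_sum_le_of_le _ fun k _ => ?_
          rw [norm_pow]
          calc ‖minorRow A z i k‖ ^ 2 ≤ (1 / 10 ^ 5 : ℝ) ^ 2 := by gcongr; exact h2 k
            _ = _ := by norm_num
      _ = (Fintype.card {j // j ≠ i} : ℝ) * (1 / 10 ^ 10) := by simp
      _ ≤ _ := by
          gcongr
          exact Fintype.card_subtype_le _
  have hdt : ‖(1 / N) * (t - t0)‖ ≤ 9 / 10 ^ 5 := by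
    rw [htr, norm_mul, norm_div, norm_one, hNn, norm_mul]
    have : ‖1 + ∑ j, minorRow A z i j ^ 2‖ ≤ 1 + (Fintype.card ι : ℝ) * (1 / 10 ^ 10) :=
      (norm_add_le _ _).trans (by rw [norm_one]; gcongr)
    calc 1 / (Fintype.card ι : ℝ) * (‖greenFunction A z i i‖ * ‖1 + ∑ j, minorRow A z i j ^ 2‖)
        ≤ 1 / (Fintype.card ι : ℝ) * (84 * (1 + (Fintype.card ι : ℝ) * (1 / 10 ^ 10))) := by
          gcongr
      _ = 84 * (1 / (Fintype.card ι : ℝ)) + 84 / 10 ^ 10 := by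
          have : (Fintype.card ι : ℝ) ≠ 0 := by positivity
          field_simp
      _ ≤ 84 * (1 / 10 ^ 6) + 84 / 10 ^ 10 := by gcongr
      _ ≤ 9 / 10 ^ 5 := by norm_num
  have heq : greenFunction A z i i * (z + (1 / N) * t) + 1
      = greenFunction A z i i * ((A i i : ℂ) - (S - (1 / N) * t0) + (1 / N) * (t - t0)) := by
    linear_combination -hschur
  rw [heq, norm_mul]
  gcongr
  calc _ ≤ ‖(A i i : ℂ)‖ + ‖S - (1 / N) * t0‖ + ‖(1 / N) * (t - t0)‖ :=
        (norm_add_le _ _).trans (by gcongr; exact norm_sub_le _ _)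
    _ ≤ 1 / 10 ^ 5 + 1 / 10 ^ 5 + 9 / 10 ^ 5 := by
        gcongr
        rwa [Complex.norm_real, Real.norm_eq_abs]
    _ ≤ 1 / 5000 := by norm_num

/-- The self-improving bound on the diagonal of the Green function at bounded energies. -/
theorem norm_greenFunction_diag_le_of_near {A : Matrix ι ι ℝ} (hA : A.IsSymm) {z : ℂ}
    (hz : 0 < z.im) (hzn : ‖z‖ ≤ 12) (hN : 10 ^ 6 ≤ Fintype.card ι)
    (hB : ∀ i, ‖greenFunction A z i i‖ ≤ 84) (hd : ∀ i, |A i i| ≤ 1 / 10 ^ 5)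
    (hrow : ∀ i, RowConcentrated A z i (1 / 10 ^ 5)) (i : ι) :
    ‖greenFunction A z i i‖ ≤ 21 := by
  set N : ℂ := (Fintype.card ι : ℂ) with hNdef
  have hNr : (10 : ℝ) ^ 6 ≤ (Fintype.card ι : ℝ) := by exact_mod_cast hN
  have hN0 : (Fintype.card ι : ℝ) ≠ 0 := by positivity
  have hNc : N ≠ 0 := by rw [hNdef]; exact_mod_cast hN0
  have hNn : ‖N‖ = (Fintype.card ι : ℝ) := by simp [hNdef]
  set s := (1 / N) * ∑ j, greenFunction A z j j with hs
  have key : ∀ i, ‖greenFunction A z i i * (z + s) + 1‖ ≤ ‖greenFunction A z i i‖ * (1 / 5000) :=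
    fun i => norm_self_consistent_le hA hz hN i (hB i) (hd i) (hrow i)
  -- Average of `key` over `i`; the error is `84 / 5000`.
  have havg : ‖s * (z + s) + 1‖ ≤ 17 / 1000 := by
    have h1 : s * (z + s) + 1 = (1 / N) * ∑ i, (greenFunction A z i i * (z + s) + 1) := by
      rw [Finset.sum_add_distrib, ← Finset.sum_mul, Finset.sum_const, Finset.card_univ,
        nsmul_eq_mul, mul_one, ← hNdef, ← show N * s = ∑ j, greenFunction A z j j by
          rw [hs, ← mul_assoc, mul_one_div_cancel hNc, one_mul]]
      field_simp
    rw [h1, norm_mul, norm_div, norm_one, hNn]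
    calc 1 / (Fintype.card ι : ℝ) * ‖∑ i, (greenFunction A z i i * (z + s) + 1)‖
        ≤ 1 / (Fintype.card ι : ℝ) * ∑ i : ι, (17 / 1000 : ℝ) := by
          gcongr
          refine norm_sum_le_of_le _ fun i _ => (key i).trans ?_
          linarith [hB i]
      _ = 17 / 1000 := by
          rw [Finset.sum_const, Finset.card_univ, nsmul_eq_mul]; field_simp
  -- If `z + s` were small then `|s|` would be at most about `12`, so `s (z + s)` would be far from
  -- `-1`. This is where bounded energy enters.
  have hlow : 1 / 20 ≤ ‖z + s‖ := by
    by_contra! hlt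
    have h1 : ‖s‖ ≤ 12 + 1 / 20 := by
      calc ‖s‖ = ‖(z + s) - z‖ := by rw [add_sub_cancel_left]
        _ ≤ ‖z + s‖ + ‖z‖ := norm_sub_le _ _
        _ ≤ _ := by linarith
    have h2 : (1 : ℝ) ≤ ‖s * (z + s) + 1‖ + ‖s * (z + s)‖ := by
      calc (1 : ℝ) = ‖(s * (z + s) + 1) - s * (z + s)‖ := by simp
        _ ≤ _ := norm_sub_le _ _
    have h3 : ‖s * (z + s)‖ ≤ (12 + 1 / 20) * (1 / 20) := by rw [norm_mul]; gcongr
    linarith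
  have h4 : ‖greenFunction A z i i‖ * ‖z + s‖ ≤ 1 + ‖greenFunction A z i i‖ * (1 / 5000) := by
    calc ‖greenFunction A z i i‖ * ‖z + s‖ = ‖(greenFunction A z i i * (z + s) + 1) - 1‖ := by
          rw [add_sub_cancel_right, norm_mul]
      _ ≤ ‖greenFunction A z i i * (z + s) + 1‖ + ‖(1 : ℂ)‖ := norm_sub_le _ _
      _ ≤ _ := by rw [norm_one]; linarith [key i]
  have := mul_le_mul_of_nonneg_left hlow (norm_nonneg (greenFunction A z i i))
  linarith

/-- The self-improving bound on the diagonal of the Green function at large energies. -/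
theorem norm_greenFunction_diag_le_of_far {A : Matrix ι ι ℝ} (hA : A.IsSymm) {z : ℂ}
    (hz : 0 < z.im) (hzn : 10 ≤ ‖z‖) (hN : 10 ^ 6 ≤ Fintype.card ι)
    (hB : ∀ i, ‖greenFunction A z i i‖ ≤ 1) (hd : ∀ i, |A i i| ≤ 1 / 10 ^ 5)
    (hrow : ∀ i, RowConcentrated A z i (1 / 10 ^ 5)) (i : ι) :
    ‖greenFunction A z i i‖ ≤ 1 / 4 := by
  have hN0 : (Fintype.card ι : ℝ) ≠ 0 := by
    have : (10 : ℝ) ^ 6 ≤ (Fintype.card ι : ℝ) := by exact_mod_cast hN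
    positivity
  have hs : ‖(1 / (Fintype.card ι : ℂ)) * ∑ j, greenFunction A z j j‖ ≤ 1 := by
    rw [norm_mul, norm_div, norm_one, Complex.norm_natCast]
    calc 1 / (Fintype.card ι : ℝ) * ‖∑ j, greenFunction A z j j‖
        ≤ 1 / (Fintype.card ι : ℝ) * ∑ i : ι, (1 : ℝ) := by
          gcongr
          exact norm_sum_le_of_le _ fun i _ => hB i
      _ = 1 := by simp [hN0]
  have key := norm_self_consistent_le hA hz hN i ((hB i).trans (by norm_num)) (hd i) (hrow i)
  set s := (1 / (Fintype.card ι : ℂ)) * ∑ j, greenFunction A z j j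
  -- At large energies the a priori bound on `s` suffices.
  have hlow : 9 ≤ ‖z + s‖ := by
    have : ‖z‖ ≤ ‖z + s‖ + ‖s‖ := by
      calc ‖z‖ = ‖(z + s) - s‖ := by rw [add_sub_cancel_right]
        _ ≤ _ := norm_sub_le _ _
    linarith
  have h4 : ‖greenFunction A z i i‖ * ‖z + s‖ ≤ 1 + ‖greenFunction A z i i‖ * (1 / 5000) := by
    calc ‖greenFunction A z i i‖ * ‖z + s‖ = ‖(greenFunction A z i i * (z + s) + 1) - 1‖ := by
          rw [add_sub_cancel_right, norm_mul]
      _ ≤ ‖greenFunction A z i i * (z + s) + 1‖ + ‖(1 : ℂ)‖ := norm_sub_le _ _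
      _ ≤ _ := by rw [norm_one]; linarith
  have := mul_le_mul_of_nonneg_left hlow (norm_nonneg (greenFunction A z i i))
  linarith

/-- All entries of the Green functions of `A` and of its minors are bounded by `B`. -/
def GreenBounded (A : Matrix ι ι ℝ) (z : ℂ) (B : ℝ) : Prop :=
  (∀ j k, ‖greenFunction A z j k‖ ≤ B) ∧
    ∀ i j k, ‖greenFunction (minor A i) z j k‖ ≤ B

/-- Off-diagonal entries are `-G_ii` times `minorRow`, hence no larger than `g`. Passing to a minor
adds one product `G_ji · minorRow`, whence the factor 2. -/
theorem greenBounded_of_diag {A : Matrix ι ι ℝ} (hA : A.IsSymm) {z : ℂ} (hz : 0 < z.im) {g : ℝ}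
    (hg : ∀ i, ‖greenFunction A z i i‖ ≤ g)
    (hrow : ∀ i k, ‖minorRow A z i k‖ ≤ 1) : GreenBounded A z (2 * g) := by
  have h1 : ∀ j k, ‖greenFunction A z j k‖ ≤ g := by
    intro j k
    have hg0 : 0 ≤ g := (norm_nonneg _).trans (hg j)
    by_cases h : k = j
    · rw [h]; exact hg j
    · have := greenFunction_row_eq hA hz j ⟨k, h⟩
      simp only at this
      rw [this, norm_mul, norm_neg]
      calc _ ≤ g * 1 := by gcongr; exacts [hg j, hrow j ⟨k, h⟩]
        _ = g := mul_one g
  refine ⟨fun j k => ?_, fun i j k => ?_⟩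
  · linarith [h1 j k, (norm_nonneg _).trans (h1 j k)]
  · have hg0 : 0 ≤ g := (norm_nonneg _).trans (hg i)
    have h2 := greenFunction_eq_minor hA hz i j k
    have h3 : greenFunction (minor A i) z j k
        = greenFunction A z j k + greenFunction A z j i * minorRow A z i k := by rw [h2]; ring
    rw [h3]
    calc _ ≤ ‖greenFunction A z j k‖ + ‖greenFunction A z j i‖ * ‖minorRow A z i k‖ :=
          (norm_add_le _ _).trans (by rw [norm_mul])
      _ ≤ g + g * 1 := by gcongr; exacts [h1 _ _, h1 _ _, hrow _ _]
      _ = 2 * g := by ring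

/-- The bound carried along the induction on scales at energy `E`. -/
noncomputable def energyBound (E : ℝ) : ℝ := if |E| ≤ 10 then 42 else 1 / 2

theorem energyBound_le (E : ℝ) : energyBound E ≤ 42 := by
  rw [energyBound]; split_ifs <;> norm_num

theorem le_energyBound (E : ℝ) : 1 / 2 ≤ energyBound E := by
  rw [energyBound]; split_ifs <;> norm_num

theorem greenBounded_top {A : Matrix ι ι ℝ} (hA : A.IsSymm) {E η : ℝ} (hη : 2 ≤ η) :
    GreenBounded A ⟨E, η⟩ (energyBound E) := by
  have h : 1 / η ≤ energyBound E := by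
    refine le_trans ?_ (le_energyBound E)
    gcongr
  have hη0 : 0 < η := by linarith
  exact ⟨fun j k => (norm_greenFunction_le hA hη0 j k).trans h,
    fun i j k => (norm_greenFunction_le (minor_isSymm hA i) hη0 j k).trans h⟩

theorem greenBounded_half {A : Matrix ι ι ℝ} (hA : A.IsSymm) {E η B : ℝ} (hη : 0 < η)
    (h : GreenBounded A ⟨E, 2 * η⟩ B) : GreenBounded A ⟨E, η⟩ (2 * B) :=
  ⟨fun j k => norm_greenFunction_half_le hA hη h.1 j k,
    fun i j k => norm_greenFunction_half_le (minor_isSymm hA i) hη (h.2 i) j k⟩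

/-- One step of the induction on scales. -/
theorem greenBounded_step {A : Matrix ι ι ℝ} (hA : A.IsSymm) {E η : ℝ} (hη : 0 < η) (hη2 : η ≤ 2)
    (hN : 10 ^ 6 ≤ Fintype.card ι) (hd : ∀ i, |A i i| ≤ 1 / 10 ^ 5)
    (hB : GreenBounded A ⟨E, 2 * η⟩ (energyBound E))
    (hrow : ∀ i, (∀ j k, ‖greenFunction (minor A i) ⟨E, η⟩ j k‖ ≤ 84) →
      RowConcentrated A ⟨E, η⟩ i (1 / 10 ^ 5)) :
    GreenBounded A ⟨E, η⟩ (energyBound E) := by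
  have hhalf := greenBounded_half hA hη hB
  have hE := energyBound_le E
  have hrow' : ∀ i, RowConcentrated A ⟨E, η⟩ i (1 / 10 ^ 5) := fun i =>
    hrow i fun j k => (hhalf.2 i j k).trans (by linarith)
  have hrow1 : ∀ i k, ‖minorRow A ⟨E, η⟩ i k‖ ≤ 1 := fun i k =>
    ((hrow' i).2 k).trans (by norm_num)
  -- The two values of `energyBound` reproduce themselves: `2 · 21 = 42` near the origin and `2 ·
  -- (1/4) = 1/2` far from it.
  by_cases h : |E| ≤ 10
  · have hz : ‖(⟨E, η⟩ : ℂ)‖ ≤ 12 := by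
      refine (Complex.norm_le_abs_re_add_abs_im _).trans ?_
      simp only [abs_of_pos hη]
      linarith
    have h1 := greenBounded_of_diag hA hη (norm_greenFunction_diag_le_of_near hA hη hz hN
      (fun i => (hhalf.1 i i).trans (by linarith)) hd hrow') hrow1
    rw [energyBound, if_pos h]
    convert h1 using 1
    norm_num
  · have hz : 10 ≤ ‖(⟨E, η⟩ : ℂ)‖ :=
      (le_of_lt (not_le.mp h)).trans (Complex.abs_re_le_norm (⟨E, η⟩ : ℂ))
    have hE' : energyBound E = 1 / 2 := by rw [energyBound, if_neg h]
    have h1 := greenBounded_of_diag hA hη (norm_greenFunction_diag_le_of_far hA hη hz hN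
      (fun i => (hhalf.1 i i).trans (by linarith)) hd hrow') hrow1
    rw [hE']
    convert h1 using 1
    norm_num

end Bootstrap

/-! ### Concentration for sums of independent sparse random variables -/

section Concentration

variable {Ω : Type*} [MeasurableSpace Ω] {μ : Measure Ω}

/-- A Poisson-type bound on the exponential moments of `Y`. -/
def HasPoissonMGF (μ : Measure Ω) (Y : Ω → ℝ) (v b : ℝ) : Prop :=
  ∀ t : ℝ, ∫⁻ ω, ENNReal.ofReal (Real.exp (t * Y ω)) ∂μ
    ≤ ENNReal.ofReal (Real.exp (t ^ 2 * v * Real.exp (|t| * b)))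

theorem exp_le_one_add_add_sq_mul_exp_abs (s : ℝ) :
    Real.exp s ≤ 1 + s + s ^ 2 * Real.exp |s| := by
  have h1 : ∀ r : ℝ, Real.exp r - 1 ≤ r * Real.exp r := by
    intro r
    have := Real.add_one_le_exp (-r)
    have h2 : Real.exp r * Real.exp (-r) = 1 := by rw [← Real.exp_add]; simp
    nlinarith [Real.exp_pos r]
  rcases le_or_gt 0 s with hs | hs
  · rw [abs_of_nonneg hs]
    nlinarith [h1 s]
  · rw [abs_of_neg hs]
    have h2 : 1 ≤ Real.exp (-s) := Real.one_le_exp (by linarith)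
    have h3 := Real.add_one_le_exp s
    nlinarith [h1 s, sq_nonneg s]

/-- Integrate `e^s ≤ 1 + s + s² e^|s|` at `s = t Z`, then use `1 + x ≤ e^x`. Here `b` and `v` bound
`Z` and its second moment before centring, so centring costs no constant. -/
theorem hasPoissonMGF_of_bounded [IsProbabilityMeasure μ] {Z : Ω → ℝ} {m v b : ℝ}
    (hZ : Measurable Z) (hb : ∀ᵐ ω ∂μ, |Z ω| ≤ b) (hm : ∫ ω, Z ω ∂μ = m)
    (hv : ∫ ω, Z ω ^ 2 ∂μ ≤ v) : HasPoissonMGF μ (fun ω => Z ω - m) v b := by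
  intro t
  have hint : Integrable Z μ := Integrable.of_bound hZ.aestronglyMeasurable b (by simpa using hb)
  have hint2 : Integrable (fun ω => Z ω ^ 2) μ :=
    Integrable.of_bound (hZ.pow_const 2).aestronglyMeasurable (b ^ 2) (by
      filter_upwards [hb] with ω h
      rw [norm_pow]
      gcongr
      simpa using h)
  have hinte : Integrable (fun ω => Real.exp (t * Z ω)) μ :=
    Integrable.of_bound (by fun_prop) (Real.exp (|t| * b)) (by
      filter_upwards [hb] with ω h
      rw [Real.norm_eq_abs, Real.abs_exp]
      refine Real.exp_le_exp.mpr ((le_abs_self _).trans ?_)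
      rw [abs_mul]; gcongr)
  have hv0 : 0 ≤ v := (integral_nonneg fun ω => sq_nonneg _).trans hv
  have hmain : ∫ ω, Real.exp (t * Z ω) ∂μ ≤ 1 + t * m + t ^ 2 * v * Real.exp (|t| * b) := by
    calc ∫ ω, Real.exp (t * Z ω) ∂μ
        ≤ ∫ ω, (1 + t * Z ω + (t ^ 2 * Real.exp (|t| * b)) * Z ω ^ 2) ∂μ := by
          refine integral_mono_ae hinte
            (((integrable_const _).add (hint.const_mul _)).add (hint2.const_mul _)) ?_
          filter_upwards [hb] with ω h
          have h1 := exp_le_one_add_add_sq_mul_exp_abs (t * Z ω)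
          have h2 : (t * Z ω) ^ 2 * Real.exp |t * Z ω|
              ≤ (t * Z ω) ^ 2 * Real.exp (|t| * b) := by
            rw [abs_mul]; gcongr
          nlinarith
      _ = 1 + t * m + (t ^ 2 * Real.exp (|t| * b)) * ∫ ω, Z ω ^ 2 ∂μ := by
          rw [integral_add (f := fun ω => 1 + t * Z ω)
              ((integrable_const _).add (hint.const_mul _)) (hint2.const_mul _),
            integral_add (integrable_const _) (hint.const_mul _), integral_const_mul,
            integral_const_mul, hm]
          simp
      _ ≤ _ := by
          have : (t ^ 2 * Real.exp (|t| * b)) * ∫ ω, Z ω ^ 2 ∂μ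
              ≤ (t ^ 2 * Real.exp (|t| * b)) * v := by gcongr
          linarith
  have heq : ∀ ω, Real.exp (t * (Z ω - m)) = Real.exp (-(t * m)) * Real.exp (t * Z ω) := by
    intro ω; rw [← Real.exp_add]; congr 1; ring
  simp_rw [heq]
  rw [← ofReal_integral_eq_lintegral_ofReal (hinte.const_mul _)
    (Filter.Eventually.of_forall fun ω => by positivity), integral_const_mul]
  refine ENNReal.ofReal_le_ofReal ?_
  calc Real.exp (-(t * m)) * ∫ ω, Real.exp (t * Z ω) ∂μ
      ≤ Real.exp (-(t * m)) * Real.exp (t * m + t ^ 2 * v * Real.exp (|t| * b)) := by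
        gcongr
        refine hmain.trans ?_
        have := Real.add_one_le_exp (t * m + t ^ 2 * v * Real.exp (|t| * b))
        linarith
    _ = _ := by rw [← Real.exp_add]; congr 1; ring

/-- Fubini for independent variables: it freezes the past of the supermartingale, and later the
minor of the matrix. -/
theorem lintegral_comp_prodMk_of_indepFun [IsProbabilityMeasure μ] {β γ : Type*}
    [MeasurableSpace β] [MeasurableSpace γ] {U : Ω → β} {Y : Ω → γ} (hU : Measurable U)
    (hY : Measurable Y) (hUY : IndepFun U Y μ) {h : β × γ → ENNReal} (hh : Measurable h) :
    ∫⁻ ω, h (U ω, Y ω) ∂μ = ∫⁻ ω, ∫⁻ ω', h (U ω, Y ω') ∂μ ∂μ := by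
  have hmap := (indepFun_iff_map_prod_eq_prod_map_map hU.aemeasurable hY.aemeasurable).mp hUY
  have := Measure.isProbabilityMeasure_map (μ := μ) hU.aemeasurable
  have := Measure.isProbabilityMeasure_map (μ := μ) hY.aemeasurable
  calc ∫⁻ ω, h (U ω, Y ω) ∂μ = ∫⁻ p, h p ∂(μ.map fun ω => (U ω, Y ω)) := by
        rw [lintegral_map hh (hU.prodMk hY)]
    _ = ∫⁻ u, ∫⁻ y, h (u, y) ∂(μ.map Y) ∂(μ.map U) := by
        rw [hmap, lintegral_prod _ hh.aemeasurable]
    _ = ∫⁻ ω, ∫⁻ y, h (U ω, y) ∂(μ.map Y) ∂μ := by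
        rw [lintegral_map hh.lintegral_prod_right' hU]
    _ = _ := by
        refine lintegral_congr fun ω => ?_
        rw [lintegral_map (f := fun y => h (U ω, y)) (hh.comp measurable_prodMk_left) hY]

variable {ι : Type*} [LinearOrder ι]

/-- The predictable coefficient `g_k + ∑_{j < k} G_{jk} x_j`, the sum being over `s`. -/
def predictable (s : Finset ι) (g : ι → ℝ) (G : ι → ι → ℝ) (x : ι → ℝ) (k : ι) : ℝ :=
  g k + ∑ j ∈ s with j < k, G j k * x j

/-- The logarithm of the exponential supermartingale. -/
noncomputable def compensated (v b t : ℝ) (s : Finset ι) (g : ι → ℝ) (G : ι → ι → ℝ)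
    (x : ι → ℝ) : ℝ :=
  ∑ k ∈ s, (t * predictable s g G x k * x k
    - (t * predictable s g G x k) ^ 2 * v * Real.exp (|t * predictable s g G x k| * b))

theorem measurable_predictable (s : Finset ι) (g : ι → ℝ) (G : ι → ι → ℝ) (k : ι) :
    Measurable fun x => predictable s g G x k := by
  unfold predictable; fun_prop

theorem measurable_compensated (v b t : ℝ) (s : Finset ι) (g : ι → ℝ) (G : ι → ι → ℝ) :
    Measurable (compensated v b t s g G) := by
  unfold compensated predictable; fun_prop

theorem predictable_congr {s : Finset ι} {g : ι → ℝ} {G : ι → ι → ℝ} {x y : ι → ℝ}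
    (h : ∀ j ∈ s, x j = y j) (k : ι) : predictable s g G x k = predictable s g G y k := by
  unfold predictable
  congr 1
  exact Finset.sum_congr rfl fun j hj => by rw [h j (Finset.mem_filter.mp hj).1]

theorem compensated_congr {v b t : ℝ} {s : Finset ι} {g : ι → ℝ} {G : ι → ι → ℝ} {x y : ι → ℝ}
    (h : ∀ j ∈ s, x j = y j) : compensated v b t s g G x = compensated v b t s g G y := by
  unfold compensated
  exact Finset.sum_congr rfl fun j hj => by rw [predictable_congr h, h j hj]

theorem predictable_insert {a : ι} {s : Finset ι} (g : ι → ℝ) (G : ι → ι → ℝ)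
    (x : ι → ℝ) {k : ι} (hk : k ≤ a) :
    predictable (insert a s) g G x k = predictable s g G x k := by
  unfold predictable
  rw [Finset.filter_insert, if_neg (not_lt.mpr hk)]

theorem compensated_insert {v b t : ℝ} {a : ι} {s : Finset ι} (ha : ∀ x ∈ s, x < a) (g : ι → ℝ)
    (G : ι → ι → ℝ) (x : ι → ℝ) :
    compensated v b t (insert a s) g G x = compensated v b t s g G x
      + (t * predictable s g G x a * x a
        - (t * predictable s g G x a) ^ 2 * v * Real.exp (|t * predictable s g G x a| * b)) := by
  have has : a ∉ s := fun h => lt_irrefl _ (ha a h)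
  unfold compensated
  rw [Finset.sum_insert has, add_comm, predictable_insert g G x le_rfl]
  congr 1
  exact Finset.sum_congr rfl fun k hk => by rw [predictable_insert g G x (ha k hk).le]

/-- The exponential supermartingale has expectation at most one. -/
theorem lintegral_exp_compensated_le [IsProbabilityMeasure μ] {X : ι → Ω → ℝ}
    (hX : ∀ j, Measurable (X j)) (hind : iIndepFun X μ) {v b : ℝ}
    (hmgf : ∀ j, HasPoissonMGF μ (X j) v b) (t : ℝ) (g : ι → ℝ) (G : ι → ι → ℝ) (s : Finset ι) :
    ∫⁻ ω, ENNReal.ofReal (Real.exp (compensated v b t s g G fun j => X j ω)) ∂μ ≤ 1 := by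
  classical
  -- Indices are added in increasing order, so the coefficient of the new variable depends only on
  -- earlier ones.
  induction s using Finset.induction_on_max with
  | empty => simp [compensated]
  | insert a s ha ih =>
    have has : a ∉ s := fun h => lt_irrefl _ (ha a h)
    -- Extension by zero makes `U` a function of `(X_j)` for `j ∈ s` alone, as independence
    -- requires; the value 0 is never read.
    let ext : (s → ℝ) → ι → ℝ := fun y j => if h : j ∈ s then y ⟨j, h⟩ else 0
    have hext : Measurable ext := by
      refine measurable_pi_lambda _ fun j => ?_
      by_cases h : j ∈ s
      · simp only [ext, h, dif_pos]; fun_prop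
      · simp only [ext, h, dif_neg, not_false_eq_true]; fun_prop
    let φ : (s → ℝ) → ℝ × ℝ := fun y => (compensated v b t s g G (ext y),
      predictable s g G (ext y) a)
    have hφ : Measurable φ :=
      ((measurable_compensated v b t s g G).comp hext).prodMk
        ((measurable_predictable s g G a).comp hext)
    let U : Ω → ℝ × ℝ := fun ω => (compensated v b t s g G fun j => X j ω,
      predictable s g G (fun j => X j ω) a)
    have hUφ : U = φ ∘ fun ω (j : s) => X j ω := by
      funext ω
      have : ∀ j ∈ s, X j ω = ext (fun j : s => X j ω) j := fun j hj => by simp [ext, hj]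
      simp only [U, φ, Function.comp]
      rw [compensated_congr this, predictable_congr this]
    have hU : Measurable U := by
      rw [hUφ]; exact hφ.comp (measurable_pi_lambda _ fun j => hX j)
    have hUX : IndepFun U (X a) μ := by
      have h1 := hind.indepFun_finset s {a} (Finset.disjoint_singleton_right.mpr has) hX
      have h2 := h1.comp hφ (measurable_pi_apply (⟨a, Finset.mem_singleton_self a⟩ : ({a} : Finset ι)))
      rw [hUφ]
      exact h2
    let h : (ℝ × ℝ) × ℝ → ENNReal := fun p => ENNReal.ofReal (Real.exp (p.1.1
      + (t * p.1.2 * p.2 - (t * p.1.2) ^ 2 * v * Real.exp (|t * p.1.2| * b))))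
    have hh : Measurable h := by fun_prop
    calc ∫⁻ ω, ENNReal.ofReal (Real.exp (compensated v b t (insert a s) g G fun j => X j ω)) ∂μ
        = ∫⁻ ω, h (U ω, X a ω) ∂μ := by
          simp only [h, U]
          exact lintegral_congr fun ω => by rw [compensated_insert ha]
      _ = ∫⁻ ω, ∫⁻ ω', h (U ω, X a ω') ∂μ ∂μ := lintegral_comp_prodMk_of_indepFun hU (hX a) hUX hh
      _ ≤ ∫⁻ ω, ENNReal.ofReal (Real.exp (compensated v b t s g G fun j => X j ω)) ∂μ := by
          refine lintegral_mono fun ω => ?_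
          set F := compensated v b t s g G fun j => X j ω with hF
          set w := t * predictable s g G (fun j => X j ω) a with hw
          -- With the past frozen, `hmgf a w` cancels precisely the compensator of index `a`.
          have hsplit : ∀ ω', h (U ω, X a ω')
              = ENNReal.ofReal (Real.exp (F - w ^ 2 * v * Real.exp (|w| * b)))
                * ENNReal.ofReal (Real.exp (w * X a ω')) := by
            intro ω'
            rw [← ENNReal.ofReal_mul (Real.exp_nonneg _), ← Real.exp_add]
            simp only [h, U, ← hF, ← hw]
            congr 2; ring
          simp_rw [hsplit]
          rw [lintegral_const_mul _ (by have := hX a; fun_prop)]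
          calc _ ≤ ENNReal.ofReal (Real.exp (F - w ^ 2 * v * Real.exp (|w| * b)))
                * ENNReal.ofReal (Real.exp (w ^ 2 * v * Real.exp (|w| * b))) := by
                gcongr
                exact hmgf a w
            _ = _ := by
                rw [← ENNReal.ofReal_mul (Real.exp_nonneg _), ← Real.exp_add]
                congr 2; ring
      _ ≤ 1 := ih

variable [Fintype ι]

/-- Chernoff's method: on this event the compensator is at most `t² V e^(tβb)`, so Markov's
inequality for the exponential supermartingale applies. The coefficients are random, so their bounds
belong to the event. -/
theorem measure_chaos_ge_le [IsProbabilityMeasure μ] {X : ι → Ω → ℝ}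
    (hX : ∀ j, Measurable (X j)) (hind : iIndepFun X μ) {v b : ℝ} (hv : 0 ≤ v) (hb : 0 ≤ b)
    (hmgf : ∀ j, HasPoissonMGF μ (X j) v b) (g : ι → ℝ) (G : ι → ι → ℝ) {s t β V : ℝ}
    (ht : 0 ≤ t) :
    μ.real {ω | s ≤ ∑ k, X k ω * predictable Finset.univ g G (fun j => X j ω) k ∧
        (∀ k, |predictable Finset.univ g G (fun j => X j ω) k| ≤ β) ∧
        v * ∑ k, predictable Finset.univ g G (fun j => X j ω) k ^ 2 ≤ V}
      ≤ Real.exp (-(t * s) + t ^ 2 * V * Real.exp (t * β * b)) := by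
  set c := t * s - t ^ 2 * V * Real.exp (t * β * b) with hc
  have hmeas : Measurable fun ω =>
      ENNReal.ofReal (Real.exp (compensated v b t Finset.univ g G fun j => X j ω)) := by
    have := (measurable_compensated v b t Finset.univ g G).comp (measurable_pi_lambda _ hX)
    exact (Real.measurable_exp.comp this).ennreal_ofReal
  have hsub : {ω | s ≤ ∑ k, X k ω * predictable Finset.univ g G (fun j => X j ω) k ∧
        (∀ k, |predictable Finset.univ g G (fun j => X j ω) k| ≤ β) ∧
        v * ∑ k, predictable Finset.univ g G (fun j => X j ω) k ^ 2 ≤ V}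
      ⊆ {ω | ENNReal.ofReal (Real.exp c) ≤
        ENNReal.ofReal (Real.exp (compensated v b t Finset.univ g G fun j => X j ω))} := by
    rintro ω ⟨h1, h2, h3⟩
    refine ENNReal.ofReal_le_ofReal (Real.exp_le_exp.mpr ?_)
    set W := predictable Finset.univ g G (fun j => X j ω) with hW
    have h4 : compensated v b t Finset.univ g G (fun j => X j ω)
        = t * ∑ k, X k ω * W k - ∑ k, (t * W k) ^ 2 * v * Real.exp (|t * W k| * b) := by
      rw [compensated, Finset.sum_sub_distrib, Finset.mul_sum]
      congr 1
      exact Finset.sum_congr rfl fun k _ => by ring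
    have h5 : ∑ k, (t * W k) ^ 2 * v * Real.exp (|t * W k| * b)
        ≤ t ^ 2 * V * Real.exp (t * β * b) := by
      calc ∑ k, (t * W k) ^ 2 * v * Real.exp (|t * W k| * b)
          ≤ ∑ k, (t * W k) ^ 2 * v * Real.exp (t * β * b) := by
            gcongr with k _
            rw [abs_mul, abs_of_nonneg ht]
            gcongr
            exact h2 k
        _ = t ^ 2 * (v * ∑ k, W k ^ 2) * Real.exp (t * β * b) := by
            rw [Finset.mul_sum, Finset.mul_sum, Finset.sum_mul]
            exact Finset.sum_congr rfl fun k _ => by ring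
        _ ≤ _ := by gcongr
    rw [h4, hc]
    have := mul_le_mul_of_nonneg_left h1 ht
    linarith
  have hmarkov := mul_meas_ge_le_lintegral₀ (μ := μ) hmeas.aemeasurable
    (ENNReal.ofReal (Real.exp c))
  have h6 : ENNReal.ofReal (Real.exp c) * μ {ω | s ≤ ∑ k, X k ω *
          predictable Finset.univ g G (fun j => X j ω) k ∧
        (∀ k, |predictable Finset.univ g G (fun j => X j ω) k| ≤ β) ∧
        v * ∑ k, predictable Finset.univ g G (fun j => X j ω) k ^ 2 ≤ V} ≤ 1 :=
    (mul_le_mul_right (measure_mono hsub) _).trans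
      (hmarkov.trans (lintegral_exp_compensated_le hX hind hmgf t g G _))
  have h7 := ENNReal.toReal_mono ENNReal.one_ne_top h6
  rw [ENNReal.toReal_mul, ENNReal.toReal_ofReal (Real.exp_nonneg _), ENNReal.toReal_one] at h7
  rw [Measure.real, show -(t * s) + t ^ 2 * V * Real.exp (t * β * b) = -c by rw [hc]; ring,
    Real.exp_neg, ← one_div, le_div_iff₀ (Real.exp_pos _), mul_comm]
  exact h7

/-- A Freedman-type tail bound for linear and quadratic chaoses. -/
theorem measure_abs_chaos_ge_le [IsProbabilityMeasure μ] {X : ι → Ω → ℝ}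
    (hX : ∀ j, Measurable (X j)) (hind : iIndepFun X μ) {v b : ℝ} (hv : 0 ≤ v) (hb : 0 ≤ b)
    (hmgf : ∀ j, HasPoissonMGF μ (X j) v b) (g : ι → ℝ) (G : ι → ι → ℝ) {s t β V : ℝ}
    (ht : 0 ≤ t) :
    μ.real {ω | s ≤ |∑ k, X k ω * predictable Finset.univ g G (fun j => X j ω) k| ∧
        (∀ k, |predictable Finset.univ g G (fun j => X j ω) k| ≤ β) ∧
        v * ∑ k, predictable Finset.univ g G (fun j => X j ω) k ^ 2 ≤ V}
      ≤ 2 * Real.exp (-(t * s) + t ^ 2 * V * Real.exp (t * β * b)) := by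
  have h1 := measure_chaos_ge_le hX hind hv hb hmgf g G (s := s) (β := β) (V := V) ht
  have h2 := measure_chaos_ge_le hX hind hv hb hmgf (-g) (-G) (s := s) (β := β) (V := V) ht
  have hneg : ∀ x k, predictable Finset.univ (-g) (-G) x k
      = - predictable (ι := ι) Finset.univ g G x k := by
    intro x k
    simp only [predictable, Pi.neg_apply, neg_mul, Finset.sum_neg_distrib]
    ring
  simp only [hneg, abs_neg, neg_sq, mul_neg, Finset.sum_neg_distrib] at h2
  rw [two_mul]
  refine (measureReal_mono ?_).trans ((measureReal_union_le _ _).trans (add_le_add h1 h2))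
  rintro ω ⟨h, h'⟩
  rcases le_abs.mp h with h | h
  · exact Or.inl ⟨h, h'⟩
  · exact Or.inr ⟨h, h'⟩

theorem measure_abs_linear_ge_le [IsProbabilityMeasure μ] {X : ι → Ω → ℝ}
    (hX : ∀ j, Measurable (X j)) (hind : iIndepFun X μ) {v b : ℝ} (hv : 0 ≤ v) (hb : 0 ≤ b)
    (hmgf : ∀ j, HasPoissonMGF μ (X j) v b) (g : ι → ℝ) {s t β V : ℝ}
    (ht : 0 ≤ t) (hβ : ∀ k, |g k| ≤ β) (hV : v * ∑ k, g k ^ 2 ≤ V) :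
    μ.real {ω | s ≤ |∑ k, X k ω * g k|}
      ≤ 2 * Real.exp (-(t * s) + t ^ 2 * V * Real.exp (t * β * b)) := by
  have h := measure_abs_chaos_ge_le hX hind hv hb hmgf g 0 (s := s) (β := β) (V := V) ht
  have h0 : ∀ x k, predictable (ι := ι) Finset.univ g 0 x k = g k := by
    intro x k; simp [predictable]
  simp only [h0] at h
  refine (measureReal_mono ?_).trans h
  exact fun ω hω => ⟨hω, hβ, hV⟩

end Concentration

/-! ### Concentration of quadratic forms of sparse vectors -/

/-- The range of parameters: `N` is `exp (ℓ ^ 2)` and events of probability `exp (-K)` are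
negligible. -/
structure SparseRegime (N q ℓ K : ℝ) : Prop where
  one_le_N : 1 ≤ N
  ell_large : 10 ^ 5 ≤ ℓ
  K_large : 10 ≤ K
  K_le : K ≤ ℓ ^ 3
  one_le_q : 1 ≤ q
  q_le : q ≤ ℓ ^ 20
  le_q_mul_ell : 10 ^ 9 * K ≤ q * ℓ
  le_q_sq : 10 ^ 18 * K ≤ q ^ 2

namespace SparseRegime

variable {N q ℓ K : ℝ}

theorem pow_mul_exp_le {ℓ : ℝ} (h : 10 ^ 5 ≤ ℓ) : ℓ ^ 50 * Real.exp (-(ℓ / 4)) ≤ 1 := by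
  have h0 : 0 < ℓ := by linarith
  have h1 : ℓ ≤ Real.exp (ℓ / 200) := by
    have := Real.quadratic_le_exp_of_nonneg (x := ℓ / 200) (by positivity)
    nlinarith
  have h2 : ℓ ^ 50 ≤ Real.exp (ℓ / 4) := by
    calc ℓ ^ 50 ≤ Real.exp (ℓ / 200) ^ 50 := by gcongr
      _ = Real.exp (ℓ / 4) := by rw [← Real.exp_nat_mul]; congr 1; push_cast; ring
  rw [Real.exp_neg, ← div_eq_mul_inv, div_le_one (Real.exp_pos _)]
  exact h2

theorem ell_pos (h : SparseRegime N q ℓ K) : 0 < ℓ := by linarith [h.ell_large]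

theorem q_pos (h : SparseRegime N q ℓ K) : 0 < q := by linarith [h.one_le_q]

theorem N_pos (h : SparseRegime N q ℓ K) : 0 < N := by linarith [h.one_le_N]

theorem K_pos (h : SparseRegime N q ℓ K) : 0 < K := by linarith [h.K_large]

/-- A product of few powers of `ℓ` is beaten by `exp (-ℓ / 4)`. -/
theorem pow_mul_exp_le_div (h : SparseRegime N q ℓ K) {m : ℕ} (hm : m ≤ 48) :
    ℓ ^ m * Real.exp (-(ℓ / 4)) ≤ 1 / 10 ^ 10 := by
  have h0 := h.ell_pos
  have h1 : (1 : ℝ) ≤ ℓ := by linarith [h.ell_large]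
  have h2 := pow_mul_exp_le h.ell_large
  have h3 : (10 : ℝ) ^ 10 ≤ ℓ ^ 2 := by
    calc (10 : ℝ) ^ 10 = (10 ^ 5) ^ 2 := by norm_num
      _ ≤ ℓ ^ 2 := by gcongr; exact h.ell_large
  rw [le_div_iff₀ (by norm_num)]
  calc ℓ ^ m * Real.exp (-(ℓ / 4)) * 10 ^ 10 ≤ ℓ ^ 48 * Real.exp (-(ℓ / 4)) * ℓ ^ 2 := by
        gcongr
    _ = ℓ ^ 50 * Real.exp (-(ℓ / 4)) := by ring
    _ ≤ 1 := h2

end SparseRegime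

section QuadraticForm

variable {Ω : Type*} [MeasurableSpace Ω] {μ : Measure Ω} {ι : Type*} [LinearOrder ι] [Fintype ι]

/-- Independent centred variables of variance `1 / N`, bounded by `1 / q`. -/
structure IsSparseFamily (μ : Measure Ω) (N q : ℝ) (X : ι → Ω → ℝ) : Prop where
  measurable : ∀ j, Measurable (X j)
  indep : iIndepFun X μ
  bounded : ∀ j, ∀ᵐ ω ∂μ, |X j ω| ≤ 1 / q
  mean : ∀ j, ∫ ω, X j ω ∂μ = 0
  variance : ∀ j, ∫ ω, X j ω ^ 2 ∂μ = 1 / N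
  card_le : (Fintype.card ι : ℝ) ≤ N

namespace IsSparseFamily

variable [IsProbabilityMeasure μ] {N q ℓ K : ℝ} {X : ι → Ω → ℝ}

omit [LinearOrder ι] in
theorem hasPoissonMGF (hX : IsSparseFamily μ N q X) (j : ι) :
    HasPoissonMGF μ (X j) (1 / N) (1 / q) := by
  simpa using hasPoissonMGF_of_bounded (hX.measurable j) (hX.bounded j) (hX.mean j)
    (hX.variance j).le

omit [LinearOrder ι] in
-- Boundedness gives `X⁴ ≤ X² / q²`, so squares have second moment at most `1 / (q² N)`.
theorem hasPoissonMGF_sq (hX : IsSparseFamily μ N q X) (j : ι) :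
    HasPoissonMGF μ (fun ω => X j ω ^ 2 - 1 / N) (1 / q ^ 2 * (1 / N)) (1 / q ^ 2) := by
  have hb : ∀ᵐ ω ∂μ, X j ω ^ 2 ≤ 1 / q ^ 2 := by
    filter_upwards [hX.bounded j] with ω h
    rw [← sq_abs, ← one_div_pow]
    gcongr
  have hint2 : Integrable (fun ω => X j ω ^ 2) μ :=
    Integrable.of_bound ((hX.measurable j).pow_const 2).aestronglyMeasurable (1 / q ^ 2) (by
      filter_upwards [hb] with ω h
      rwa [Real.norm_eq_abs, abs_of_nonneg (sq_nonneg _)])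
  refine hasPoissonMGF_of_bounded ((hX.measurable j).pow_const 2) ?_ (hX.variance j) ?_
  · filter_upwards [hb] with ω h
    rwa [abs_of_nonneg (sq_nonneg _)]
  · calc ∫ ω, (X j ω ^ 2) ^ 2 ∂μ ≤ ∫ ω, 1 / q ^ 2 * X j ω ^ 2 ∂μ := by
          refine integral_mono_of_nonneg (Filter.Eventually.of_forall fun ω => by positivity)
            (hint2.const_mul _) ?_
          filter_upwards [hb] with ω h
          rw [sq (X j ω ^ 2)]
          gcongr
      _ = 1 / q ^ 2 * (1 / N) := by rw [integral_const_mul, hX.variance j]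

omit [LinearOrder ι] in
theorem sum_sq_le (hcard : (Fintype.card ι : ℝ) ≤ N) (hN : 0 < N) {g : ι → ℝ} {a : ℝ}
    (hg : ∀ k, |g k| ≤ a) : 1 / N * ∑ k, g k ^ 2 ≤ a ^ 2 := by
  calc 1 / N * ∑ k, g k ^ 2 ≤ 1 / N * ∑ k : ι, a ^ 2 := by
        refine mul_le_mul_of_nonneg_left (Finset.sum_le_sum fun k _ => ?_) (by positivity)
        exact sq_le_sq' (by linarith [neg_abs_le (g k), hg k]) ((le_abs_self _).trans (hg k))
    _ = (Fintype.card ι : ℝ) / N * a ^ 2 := by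
        rw [Finset.sum_const, Finset.card_univ, nsmul_eq_mul]; ring
    _ ≤ 1 * a ^ 2 := by gcongr; rwa [div_le_one hN]
    _ = a ^ 2 := one_mul _

/-- A tail bound for linear forms that only uses the size of the coefficients. -/
theorem measure_linear_le (hX : IsSparseFamily μ N q X) (hr : SparseRegime N q ℓ K) {a : ℝ}
    (ha : 0 < a) {g : ι → ℝ} (hg : ∀ k, |g k| ≤ a) :
    μ.real {ω | 2 * K * a ≤ |∑ k, X k ω * g k|} ≤ 2 * Real.exp (-K) := by
  have hN := hr.N_pos
  have hq := hr.q_pos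
  -- With `t = 1/a` the exponent is `-2K + e^(1/q)`, and `e^(1/q) ≤ 3 ≤ K`.
  refine (measure_abs_linear_ge_le hX.measurable hX.indep (by positivity) (by positivity)
    hX.hasPoissonMGF g (t := 1 / a) (by positivity) hg (sum_sq_le hX.card_le hN hg)).trans ?_
  have h1 : 1 / a * a * (1 / q) ≤ 1 := by
    rw [one_div_mul_cancel ha.ne', one_mul, div_le_one hq]; exact hr.one_le_q
  have h2 : Real.exp (1 / a * a * (1 / q)) ≤ 3 :=
    (Real.exp_le_exp.mpr h1).trans (by linarith [Real.exp_one_lt_d9])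
  have h3 : (1 / a) ^ 2 * a ^ 2 = 1 := by field_simp
  have h4 : 1 / a * (2 * K * a) = 2 * K := by field_simp
  rw [h3, h4]
  gcongr
  linarith [hr.K_large]

/-- A tail bound for quadratic chaoses that only uses the size of the coefficients. -/
theorem measure_chaos_le (hX : IsSparseFamily μ N q X) (hr : SparseRegime N q ℓ K) {a : ℝ}
    (ha : 0 < a) {P : ι → ι → ℝ} (hP : ∀ j k, |P j k| ≤ a) :
    μ.real {ω | 4 * K ^ 2 * a ≤
        |∑ k, X k ω * predictable Finset.univ 0 P (fun j => X j ω) k|}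
      ≤ (2 * N + 2) * Real.exp (-K) := by
  have hN := hr.N_pos
  have hq := hr.q_pos
  have hK := hr.K_pos
  set β := 2 * K * a with hβ
  have hβ0 : 0 < β := by positivity
  have hpred : ∀ ω k, predictable Finset.univ 0 P (fun j => X j ω) k
      = ∑ j, X j ω * (if j < k then P j k else 0) := by
    intro ω k
    simp [predictable, Finset.sum_filter, mul_comm]
  -- The random coefficients are linear forms, so they stay below `β` up to a union bound over `k`;
  -- then the chaos bound applies with `t = 1/β`.
  have h1 : ∀ k, μ.real {ω | β ≤ |predictable Finset.univ 0 P (fun j => X j ω) k|}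
      ≤ 2 * Real.exp (-K) := by
    intro k
    simp only [hpred]
    refine hX.measure_linear_le hr ha fun j => ?_
    split_ifs
    · exact hP j k
    · simpa using ha.le
  have h2 : μ.real (⋃ k, {ω | β ≤ |predictable Finset.univ 0 P (fun j => X j ω) k|})
      ≤ 2 * N * Real.exp (-K) := by
    refine (measureReal_iUnion_fintype_le _).trans ?_
    calc _ ≤ ∑ k : ι, 2 * Real.exp (-K) := Finset.sum_le_sum fun k _ => h1 k
      _ = (Fintype.card ι : ℝ) * (2 * Real.exp (-K)) := by
          rw [Finset.sum_const, Finset.card_univ, nsmul_eq_mul]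
      _ ≤ N * (2 * Real.exp (-K)) := by gcongr; exact hX.card_le
      _ = _ := by ring
  have h3 := measure_abs_chaos_ge_le hX.measurable hX.indep (by positivity) (by positivity)
    hX.hasPoissonMGF 0 P (s := 2 * K * β) (t := 1 / β) (β := β) (V := β ^ 2) (by positivity)
  have h4 : 2 * Real.exp (-(1 / β * (2 * K * β)) + (1 / β) ^ 2 * β ^ 2
      * Real.exp (1 / β * β * (1 / q))) ≤ 2 * Real.exp (-K) := by
    have h1 : 1 / β * β * (1 / q) ≤ 1 := by
      rw [one_div_mul_cancel hβ0.ne', one_mul, div_le_one hq]; exact hr.one_le_q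
    have h2 : Real.exp (1 / β * β * (1 / q)) ≤ 3 :=
      (Real.exp_le_exp.mpr h1).trans (by linarith [Real.exp_one_lt_d9])
    have h3 : (1 / β) ^ 2 * β ^ 2 = 1 := by field_simp
    have h4 : 1 / β * (2 * K * β) = 2 * K := by field_simp
    rw [h3, h4]
    gcongr
    linarith [hr.K_large]
  have h5 := add_le_add h2 (h3.trans h4)
  rw [← add_mul] at h5
  refine (measureReal_mono ?_).trans ((measureReal_union_le _ _).trans h5)
  intro ω hω
  by_cases hb : ∃ k, β ≤ |predictable Finset.univ 0 P (fun j => X j ω) k|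
  · exact Or.inl (Set.mem_iUnion.mpr hb)
  · push Not at hb
    refine Or.inr ⟨?_, fun k => (hb k).le, sum_sq_le hX.card_le hN fun k => (hb k).le⟩
    have : 2 * K * β = 4 * K ^ 2 * a := by rw [hβ]; ring
    rw [this]
    exact hω

/-- A tail bound for linear forms whose coefficients are small in the mean. -/
theorem measure_linear_small_le (hX : IsSparseFamily μ N q X) (hr : SparseRegime N q ℓ K)
    {g : ι → ℝ} (hg : ∀ k, |g k| ≤ 84) (hg2 : ∑ k, g k ^ 2 ≤ N * (100 * Real.exp (-ℓ))) :
    μ.real {ω | 1 / 10 ^ 6 ≤ |∑ k, X k ω * g k|} ≤ 2 * Real.exp (-K) := by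
  have hN := hr.N_pos
  have hq := hr.q_pos
  have hℓ := hr.ell_pos
  have hV : 1 / N * ∑ k, g k ^ 2 ≤ 100 * Real.exp (-ℓ) := by
    rw [one_div, inv_mul_le_iff₀ hN]; exact hg2
  -- `t` is chosen so that `tβ / q = ℓ / 2`: the resulting `e^(ℓ/2)` is still beaten by the variance
  -- `e^(-ℓ)`, while the gain `t / 10⁶` is a multiple of `q ℓ`, which exceeds `K` by `le_q_mul_ell`.
  refine (measure_abs_linear_ge_le hX.measurable hX.indep (by positivity) (by positivity)
    hX.hasPoissonMGF g (t := q * ℓ / 168) (by positivity) hg hV).trans ?_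
  have h1 : q * ℓ / 168 * 84 * (1 / q) = ℓ / 2 := by field_simp; norm_num
  rw [h1]
  have h2 : (q * ℓ / 168) ^ 2 * (100 * Real.exp (-ℓ)) * Real.exp (ℓ / 2) ≤ 1 := by
    calc (q * ℓ / 168) ^ 2 * (100 * Real.exp (-ℓ)) * Real.exp (ℓ / 2)
        = (100 / 168 ^ 2) * ((q * ℓ) ^ 2 * Real.exp (-(ℓ / 4)) * Real.exp (-(ℓ / 4))) := by
          rw [show -ℓ = -(ℓ / 4) + -(ℓ / 4) + -(ℓ / 2) by ring, Real.exp_add, Real.exp_add,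
            Real.exp_neg (ℓ / 2)]
          field_simp
      _ ≤ 1 * ((ℓ ^ 20 * ℓ) ^ 2 * Real.exp (-(ℓ / 4)) * 1) := by
          gcongr
          · norm_num
          · exact hr.q_le
          · exact Real.exp_le_one_iff.mpr (by linarith)
      _ = ℓ ^ 42 * Real.exp (-(ℓ / 4)) := by ring
      _ ≤ 1 := (hr.pow_mul_exp_le_div (by norm_num)).trans (by norm_num)
  gcongr
  linarith [hr.K_large, hr.le_q_mul_ell]

/-- Concentration of weighted sums of squares. -/
theorem measure_diag_le (hX : IsSparseFamily μ N q X) (hr : SparseRegime N q ℓ K)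
    {d : ι → ℝ} (hd : ∀ k, |d k| ≤ 84) :
    μ.real {ω | 1 / 10 ^ 6 ≤ |∑ k, (X k ω ^ 2 - 1 / N) * d k|} ≤ 2 * Real.exp (-K) := by
  have hN := hr.N_pos
  have hq := hr.q_pos
  have hK := hr.K_pos
  have hind : iIndepFun (fun k ω => X k ω ^ 2 - 1 / N) μ :=
    hX.indep.comp (fun _ x => x ^ 2 - 1 / N) fun _ => by fun_prop
  have hV : 1 / q ^ 2 * (1 / N) * ∑ k, d k ^ 2 ≤ 1 / q ^ 2 * 84 ^ 2 := by
    rw [mul_assoc]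
    gcongr
    exact sum_sq_le hX.card_le hN hd
  -- Here `t s = 2K`, and the correction is harmless because `K / q²` is tiny by `le_q_sq`.
  refine (measure_abs_linear_ge_le (fun k => ((hX.measurable k).pow_const 2).sub_const _) hind
    (by positivity) (by positivity) hX.hasPoissonMGF_sq d
    (t := 2 * 10 ^ 6 * K) (by positivity) hd hV).trans ?_
  have hKq : K * (1 / q ^ 2) ≤ 1 / 10 ^ 18 := by
    rw [mul_one_div, div_le_iff₀ (by positivity)]
    linarith [hr.le_q_sq]
  have h1 : Real.exp (2 * 10 ^ 6 * K * 84 * (1 / q ^ 2)) ≤ 3 := by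
    refine (Real.exp_le_exp.mpr (?_ : _ ≤ (1 : ℝ))).trans (by linarith [Real.exp_one_lt_d9])
    linarith
  have h2 : (2 * 10 ^ 6 * K) ^ 2 * (1 / q ^ 2 * 84 ^ 2)
      * Real.exp (2 * 10 ^ 6 * K * 84 * (1 / q ^ 2)) ≤ K := by
    calc _ ≤ (2 * 10 ^ 6 * K) ^ 2 * (1 / q ^ 2 * 84 ^ 2) * 3 := by gcongr
      _ = (4 * 10 ^ 12 * 84 ^ 2 * 3) * (K * (1 / q ^ 2)) * K := by ring
      _ ≤ (4 * 10 ^ 12 * 84 ^ 2 * 3) * (1 / 10 ^ 18) * K := by gcongr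
      _ ≤ 1 * K := by gcongr; norm_num
      _ = K := one_mul K
  gcongr
  linarith

omit [MeasurableSpace Ω] in
/-- A symmetric quadratic form is its diagonal part plus twice a chaos. -/
theorem sum_sum_eq_diag_add_chaos {M : ι → ι → ℝ} (hM : ∀ j k, M j k = M k j) (x : ι → ℝ) :
    ∑ j, ∑ k, M j k * x j * x k
      = ∑ j, M j j * x j ^ 2 + 2 * ∑ k, x k * predictable Finset.univ 0 M x k := by
  have hlow : ∑ k, x k * predictable Finset.univ 0 M x k
      = ∑ j, ∑ k, if j < k then M j k * x j * x k else 0 := by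
    rw [Finset.sum_comm]
    refine Finset.sum_congr rfl fun k _ => ?_
    rw [predictable, Pi.zero_apply, zero_add, Finset.sum_filter, Finset.mul_sum]
    refine Finset.sum_congr rfl fun j _ => ?_
    split_ifs <;> ring
  have hup : ∑ k, x k * predictable Finset.univ 0 M x k
      = ∑ j, ∑ k, if k < j then M j k * x j * x k else 0 := by
    rw [hlow, Finset.sum_comm]
    refine Finset.sum_congr rfl fun k _ => Finset.sum_congr rfl fun j _ => ?_
    rw [hM j k]
    split_ifs <;> ring
  have hdiag : ∑ j, M j j * x j ^ 2 = ∑ j, ∑ k, if j = k then M j k * x j * x k else 0 := by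
    refine Finset.sum_congr rfl fun j _ => ?_
    rw [Finset.sum_ite_eq]
    simp [sq, mul_assoc]
  rw [two_mul]
  nth_rewrite 1 [hlow]
  rw [hup, hdiag, ← Finset.sum_add_distrib, ← Finset.sum_add_distrib]
  refine Finset.sum_congr rfl fun j _ => ?_
  rw [← Finset.sum_add_distrib, ← Finset.sum_add_distrib]
  refine Finset.sum_congr rfl fun k _ => ?_
  rcases lt_trichotomy j k with h | h | h
  · simp [h, h.ne, h.not_gt]
  · simp [h]
  · simp [h, h.ne', h.not_gt]

/-- The quadratic variation of a chaos is itself a quadratic form with small coefficients. -/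
theorem measure_quadratic_variation_le (hX : IsSparseFamily μ N q X)
    (hr : SparseRegime N q ℓ K) {G : ι → ι → ℝ}
    (hG2 : ∀ j, ∑ k, G j k ^ 2 ≤ N * (100 * Real.exp (-ℓ))) :
    μ.real {ω | Real.exp (-(ℓ / 2)) ≤
        1 / N * ∑ k, predictable Finset.univ 0 G (fun j => X j ω) k ^ 2}
      ≤ (2 * N + 4) * Real.exp (-K) := by
  have hN := hr.N_pos
  have hq := hr.q_pos
  have hK := hr.K_pos
  have hℓ := hr.ell_pos
  set ρ := 100 * Real.exp (-ℓ) with hρ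
  have hρ0 : 0 < ρ := by positivity
  -- Expanding the squares turns the quadratic variation into a form with kernel `P`. By the bound
  -- on row sums of squares, the entries of `P` are at most `ρ`, so the crude chaos bound suffices:
  -- it loses only a factor `K²`.
  let P : ι → ι → ℝ := fun j j' => 1 / N * ∑ k, if j < k ∧ j' < k then G j k * G j' k else 0
  have hPsymm : ∀ j j', P j j' = P j' j := by
    intro j j'
    simp only [P]
    congr 1
    refine Finset.sum_congr rfl fun k _ => ?_
    simp only [and_comm, mul_comm]
  have hPle : ∀ j j', |P j j'| ≤ ρ := by
    intro j j'
    simp only [P]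
    rw [abs_mul, abs_of_pos (by positivity : 0 < 1 / N), one_div, inv_mul_le_iff₀ hN]
    calc |∑ k, if j < k ∧ j' < k then G j k * G j' k else 0|
        ≤ ∑ k, (G j k ^ 2 / 2 + G j' k ^ 2 / 2) := by
          refine (Finset.abs_sum_le_sum_abs _ _).trans (Finset.sum_le_sum fun k _ => ?_)
          split_ifs
          · rw [abs_le]
            constructor <;> nlinarith [sq_nonneg (G j k + G j' k), sq_nonneg (G j k - G j' k)]
          · rw [abs_zero]; positivity
      _ = (∑ k, G j k ^ 2) / 2 + (∑ k, G j' k ^ 2) / 2 := by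
          rw [Finset.sum_add_distrib, Finset.sum_div, Finset.sum_div]
      _ ≤ N * ρ := by linarith [hG2 j, hG2 j']
  have hexp : ∀ x : ι → ℝ, 1 / N * ∑ k, predictable Finset.univ 0 G x k ^ 2
      = ∑ j, P j j * x j ^ 2 + 2 * ∑ k, x k * predictable Finset.univ 0 P x k := by
    intro x
    rw [← sum_sum_eq_diag_add_chaos hPsymm]
    have h1 : ∀ k, predictable Finset.univ 0 G x k ^ 2
        = ∑ j, ∑ j', (if j < k ∧ j' < k then G j k * G j' k else 0) * x j * x j' := by
      intro k
      rw [predictable, Pi.zero_apply, zero_add, Finset.sum_filter, sq, Finset.sum_mul_sum]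
      refine Finset.sum_congr rfl fun j _ => Finset.sum_congr rfl fun j' _ => ?_
      by_cases h : j < k <;> by_cases h' : j' < k <;> simp [h, h']
      ring
    simp_rw [h1, P, Finset.mul_sum, Finset.sum_mul]
    rw [Finset.sum_comm]
    refine Finset.sum_congr rfl fun j _ => ?_
    rw [Finset.sum_comm]
    refine Finset.sum_congr rfl fun j' _ => Finset.sum_congr rfl fun k _ => ?_
    ring
  have h1 := hX.measure_chaos_le hr hρ0 hPle
  have h2 := hX.measure_diag_le hr (d := fun _ => 1) (fun _ => by norm_num)
  have h3 := add_le_add h1 h2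
  rw [← add_mul] at h3
  refine (measureReal_mono ?_).trans ((measureReal_union_le _ _).trans (h3.trans ?_))
  · intro ω hω
    by_contra hcon
    simp only [Set.mem_union, Set.mem_ofPred_eq, not_or, not_le, mul_one] at hcon
    obtain ⟨hc1, hc2⟩ := hcon
    have hsq : ∑ k, X k ω ^ 2 ≤ 2 := by
      rw [Finset.sum_sub_distrib, Finset.sum_const, Finset.card_univ, nsmul_eq_mul] at hc2
      have hc : (Fintype.card ι : ℝ) * (1 / N) ≤ 1 := by
        rw [mul_one_div, div_le_one hN]; exact hX.card_le
      linarith [(le_abs_self _).trans hc2.le]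
    have hd : ∑ j, P j j * X j ω ^ 2 ≤ ρ * 2 := by
      calc ∑ j, P j j * X j ω ^ 2 ≤ ∑ j, ρ * X j ω ^ 2 := by
            gcongr with j _
            exact (le_abs_self _).trans (hPle j j)
        _ = ρ * ∑ j, X j ω ^ 2 := by rw [Finset.mul_sum]
        _ ≤ _ := by gcongr
    have hω' : Real.exp (-(ℓ / 2)) ≤ _ := hω
    rw [hexp] at hω'
    have hlt : ρ * 2 + 2 * (4 * K ^ 2 * ρ) < Real.exp (-(ℓ / 2)) := by
      have e1 : ρ = 100 * (Real.exp (-(ℓ / 4)) * Real.exp (-(ℓ / 4)) * Real.exp (-(ℓ / 2))) := by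
        rw [hρ, ← Real.exp_add, ← Real.exp_add]; congr 2; ring
      have e2 : Real.exp (-(ℓ / 4)) ≤ 1 := Real.exp_le_one_iff.mpr (by linarith)
      have e3 : (2 + 8 * K ^ 2) * (100 * (Real.exp (-(ℓ / 4)) * Real.exp (-(ℓ / 4)))) < 1 := by
        calc (2 + 8 * K ^ 2) * (100 * (Real.exp (-(ℓ / 4)) * Real.exp (-(ℓ / 4))))
            ≤ (1 * K ^ 2 + 8 * K ^ 2) * (100 * (Real.exp (-(ℓ / 4)) * 1)) := by
              gcongr
              nlinarith [hr.K_large]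
          _ = 900 * (K ^ 2 * Real.exp (-(ℓ / 4))) := by ring
          _ ≤ 900 * ((ℓ ^ 3) ^ 2 * Real.exp (-(ℓ / 4))) := by gcongr; exact hr.K_le
          _ = 900 * (ℓ ^ 6 * Real.exp (-(ℓ / 4))) := by ring
          _ ≤ 900 * (1 / 10 ^ 10) := by
              gcongr; exact hr.pow_mul_exp_le_div (by norm_num)
          _ < 1 := by norm_num
      calc ρ * 2 + 2 * (4 * K ^ 2 * ρ) = (2 + 8 * K ^ 2) * ρ := by ring
        _ = ((2 + 8 * K ^ 2) * (100 * (Real.exp (-(ℓ / 4)) * Real.exp (-(ℓ / 4)))))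
            * Real.exp (-(ℓ / 2)) := by rw [e1]; ring
        _ < 1 * Real.exp (-(ℓ / 2)) := by gcongr
        _ = _ := one_mul _
    linarith [(le_abs_self _).trans hc1.le]
  · exact mul_le_mul_of_nonneg_right (by linarith) (Real.exp_nonneg _)

/-- A tail bound for quadratic chaoses whose coefficients are small in the mean. -/
theorem measure_chaos_small_le (hX : IsSparseFamily μ N q X)
    (hr : SparseRegime N q ℓ K) {G : ι → ι → ℝ} (hsymm : ∀ j k, G j k = G k j)
    (hG : ∀ j k, |G j k| ≤ 84) (hG2 : ∀ j, ∑ k, G j k ^ 2 ≤ N * (100 * Real.exp (-ℓ))) :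
    μ.real {ω | 1 / 10 ^ 6 ≤
        |∑ k, X k ω * predictable Finset.univ 0 G (fun j => X j ω) k|}
      ≤ (4 * N + 6) * Real.exp (-K) := by
  have hN := hr.N_pos
  have hq := hr.q_pos
  have hK := hr.K_pos
  have hℓ := hr.ell_pos
  have hpred : ∀ ω k, predictable Finset.univ 0 G (fun j => X j ω) k
      = ∑ j, X j ω * (if j < k then G j k else 0) := by
    intro ω k
    simp [predictable, Finset.sum_filter, mul_comm]
  have h1 : ∀ k, μ.real {ω | 1 / 10 ^ 6 ≤ |predictable Finset.univ 0 G (fun j => X j ω) k|}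
      ≤ 2 * Real.exp (-K) := by
    intro k
    simp only [hpred]
    refine hX.measure_linear_small_le hr (fun j => ?_) ?_
    · split_ifs
      · exact hG j k
      · simp
    · refine le_trans (Finset.sum_le_sum fun j _ => ?_) (hG2 k)
      split_ifs
      · rw [hsymm]
      · rw [zero_pow two_ne_zero]; positivity
  have h2 : μ.real (⋃ k, {ω | 1 / 10 ^ 6 ≤ |predictable Finset.univ 0 G (fun j => X j ω) k|})
      ≤ 2 * N * Real.exp (-K) := by
    refine (measureReal_iUnion_fintype_le _).trans ?_
    calc _ ≤ ∑ k : ι, 2 * Real.exp (-K) := Finset.sum_le_sum fun k _ => h1 k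
      _ = (Fintype.card ι : ℝ) * (2 * Real.exp (-K)) := by
          rw [Finset.sum_const, Finset.card_univ, nsmul_eq_mul]
      _ ≤ N * (2 * Real.exp (-K)) := by gcongr; exact hX.card_le
      _ = _ := by ring
  have h3 := hX.measure_quadratic_variation_le hr hG2
  -- On the event where all coefficients are below `β = 1` and the variation is below `e^(-ℓ/2)`,
  -- this `t` makes `tβ / q = ℓ / 8`, again dominated.
  have h4 := measure_abs_chaos_ge_le hX.measurable hX.indep (by positivity) (by positivity)
    hX.hasPoissonMGF 0 G (s := 1 / 10 ^ 6) (t := q * ℓ / 8) (β := 1) (V := Real.exp (-(ℓ / 2)))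
    (by positivity)
  have h5 : 2 * Real.exp (-(q * ℓ / 8 * (1 / 10 ^ 6)) + (q * ℓ / 8) ^ 2 * Real.exp (-(ℓ / 2))
      * Real.exp (q * ℓ / 8 * 1 * (1 / q))) ≤ 2 * Real.exp (-K) := by
    have e1 : q * ℓ / 8 * 1 * (1 / q) = ℓ / 8 := by field_simp
    rw [e1]
    have e2 : (q * ℓ / 8) ^ 2 * Real.exp (-(ℓ / 2)) * Real.exp (ℓ / 8) ≤ 1 := by
      calc (q * ℓ / 8) ^ 2 * Real.exp (-(ℓ / 2)) * Real.exp (ℓ / 8)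
          = 1 / 64 * ((q * ℓ) ^ 2 * Real.exp (-(ℓ / 4)) * Real.exp (-(ℓ / 8))) := by
            rw [show -(ℓ / 2) = -(ℓ / 4) + -(ℓ / 8) + -(ℓ / 8) by ring, Real.exp_add,
              Real.exp_add, Real.exp_neg (ℓ / 8)]
            field_simp
            norm_num
        _ ≤ 1 * ((ℓ ^ 20 * ℓ) ^ 2 * Real.exp (-(ℓ / 4)) * 1) := by
            gcongr
            · norm_num
            · exact hr.q_le
            · exact Real.exp_le_one_iff.mpr (by linarith)
        _ = ℓ ^ 42 * Real.exp (-(ℓ / 4)) := by ring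
        _ ≤ 1 := (hr.pow_mul_exp_le_div (by norm_num)).trans (by norm_num)
    gcongr
    linarith [hr.K_large, hr.le_q_mul_ell]
  have h6 := add_le_add (add_le_add h2 h3) (h4.trans h5)
  rw [← add_mul, ← add_mul] at h6
  refine (measureReal_mono ?_).trans ((measureReal_union_le _ _).trans
    ((add_le_add_left (measureReal_union_le _ _) _).trans (h6.trans
      (mul_le_mul_of_nonneg_right (by linarith) (Real.exp_nonneg _)))))
  intro ω hω
  by_cases hb : ∃ k, 1 / 10 ^ 6 ≤ |predictable Finset.univ 0 G (fun j => X j ω) k|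
  · exact Or.inl (Or.inl (Set.mem_iUnion.mpr hb))
  by_cases hv : Real.exp (-(ℓ / 2)) ≤
      1 / N * ∑ k, predictable Finset.univ 0 G (fun j => X j ω) k ^ 2
  · exact Or.inl (Or.inr hv)
  push Not at hb hv
  exact Or.inr ⟨hω, fun k => (hb k).le.trans (by norm_num), hv.le⟩

end IsSparseFamily

end QuadraticForm

/-! ### Quadratic forms of rows with the mean `f / N` added. -/

section ShiftedForm

variable {Ω : Type*} [MeasurableSpace Ω] {μ : Measure Ω} {ι : Type*} [LinearOrder ι] [Fintype ι]

namespace IsSparseFamily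

variable [IsProbabilityMeasure μ] {N q ℓ K : ℝ} {X : ι → Ω → ℝ}

omit [LinearOrder ι] in
theorem abs_sum_le_of_sum_sq_le (hcard : (Fintype.card ι : ℝ) ≤ N) (hN : 0 < N) {g : ι → ℝ}
    {σ : ℝ} (hσ : 0 ≤ σ) (hg : ∑ k, g k ^ 2 ≤ N * σ ^ 2) : |∑ k, g k| ≤ N * σ := by
  refine abs_le_of_sq_le_sq ?_ (by positivity)
  have := sq_sum_le_card_mul_sum_sq (s := Finset.univ) (f := g)
  rw [Finset.card_univ] at this
  calc (∑ k, g k) ^ 2 ≤ (Fintype.card ι : ℝ) * ∑ k, g k ^ 2 := this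
    _ ≤ N * (N * σ ^ 2) := by gcongr
    _ = (N * σ) ^ 2 := by ring

omit [LinearOrder ι] in
theorem shifted_form_eq {G : ι → ι → ℝ} (hsymm : ∀ j k, G j k = G k j) (x : ι → ℝ) (c : ℝ) :
    ∑ k, (∑ j, (x j + c) * G j k) * (x k + c)
      = ∑ j, ∑ k, G j k * x j * x k + 2 * ∑ k, x k * (c * ∑ j, G k j)
        + c * (c * ∑ k, ∑ j, G k j) := by
  have h1 : ∑ k, (∑ j, (x j + c) * G j k) * (x k + c)
      = ∑ k, (∑ j, G k j * x k * x j + x k * (c * ∑ j, G k j) + ∑ j, x j * (c * G j k)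
        + c * (c * ∑ j, G k j)) := by
    refine Finset.sum_congr rfl fun k _ => ?_
    rw [Finset.sum_mul]
    simp_rw [Finset.mul_sum]
    rw [← Finset.sum_add_distrib, ← Finset.sum_add_distrib, ← Finset.sum_add_distrib]
    refine Finset.sum_congr rfl fun j _ => ?_
    rw [hsymm k j]
    ring
  rw [h1, Finset.sum_add_distrib, Finset.sum_add_distrib, Finset.sum_add_distrib]
  have h2 : ∑ k, ∑ j, x j * (c * G j k) = ∑ k, x k * (c * ∑ j, G k j) := by
    rw [Finset.sum_comm]
    exact Finset.sum_congr rfl fun k _ => by rw [Finset.mul_sum, Finset.mul_sum]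
  rw [h2, ← Finset.mul_sum (f := fun k => c * ∑ j, G k j), ← Finset.mul_sum]
  ring

/-- Concentration of real quadratic forms of a shifted sparse vector. -/
theorem measure_shifted_form_le (hX : IsSparseFamily μ N q X)
    (hr : SparseRegime N q ℓ K) {f : ℝ} (hf0 : 0 ≤ f) (hfq : f ≤ q) {G : ι → ι → ℝ}
    (hsymm : ∀ j k, G j k = G k j) (hG : ∀ j k, |G j k| ≤ 84)
    (hG2 : ∀ j, ∑ k, G j k ^ 2 ≤ N * (100 * Real.exp (-ℓ))) :
    μ.real {ω | ¬ (|∑ k, (∑ j, (X j ω + f / N) * G j k) * (X k ω + f / N) - 1 / N * ∑ j, G j j|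
        ≤ 5 / 10 ^ 6 ∧ ∀ k, |∑ j, (X j ω + f / N) * G j k| ≤ 5 / 10 ^ 6)}
      ≤ 16 * N * Real.exp (-K) := by
  have hN := hr.N_pos
  have hq := hr.q_pos
  have hK := hr.K_pos
  have hℓ := hr.ell_pos
  -- `σ` bounds the root mean square of each kernel row. Hence row sums are at most `N σ`, and all
  -- terms containing `f` are small because `q² σ K` is.
  set σ := 10 * Real.exp (-(ℓ / 2)) with hσ
  have hσ0 : 0 < σ := by positivity
  have hσ2 : 100 * Real.exp (-ℓ) = σ ^ 2 := by
    rw [hσ, mul_pow, ← Real.exp_nat_mul]; congr 1; norm_num; congr 1; ring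
  have hqσ : q ^ 2 * σ * K ≤ 1 / 10 ^ 8 := by
    have e1 : Real.exp (-(ℓ / 2)) ≤ Real.exp (-(ℓ / 4)) :=
      Real.exp_le_exp.mpr (by linarith)
    calc q ^ 2 * σ * K ≤ (ℓ ^ 20) ^ 2 * (10 * Real.exp (-(ℓ / 4))) * ℓ ^ 3 := by
          rw [hσ]
          gcongr
          · exact hr.q_le
          · exact hr.K_le
      _ = 10 * (ℓ ^ 43 * Real.exp (-(ℓ / 4))) := by ring
      _ ≤ 10 * (1 / 10 ^ 10) := by gcongr; exact hr.pow_mul_exp_le_div (by norm_num)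
      _ ≤ 1 / 10 ^ 8 := by norm_num
  have hq1 := hr.one_le_q
  have hK1 : 1 ≤ K := by linarith [hr.K_large]
  have hfσ : f * σ ≤ 1 / 10 ^ 8 := by
    calc f * σ = f * 1 * σ * 1 := by ring
      _ ≤ q * q * σ * K := by gcongr
      _ = q ^ 2 * σ * K := by ring
      _ ≤ _ := hqσ
  have hffσ : f * (f * σ) ≤ 1 / 10 ^ 8 := by
    calc f * (f * σ) = f * f * σ * 1 := by ring
      _ ≤ q * q * σ * K := by gcongr
      _ = q ^ 2 * σ * K := by ring
      _ ≤ _ := hqσ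
  have hKqσ : 2 * K * (q * σ) ≤ 2 / 10 ^ 8 := by
    calc 2 * K * (q * σ) = 2 * (q * 1 * σ * K) := by ring
      _ ≤ 2 * (q * q * σ * K) := by gcongr
      _ = 2 * (q ^ 2 * σ * K) := by ring
      _ ≤ _ := by linarith
  have hrow : ∀ k, |∑ j, G k j| ≤ N * σ := fun k =>
    abs_sum_le_of_sum_sq_le hX.card_le hN hσ0.le (hσ2 ▸ hG2 k)
  have hcrow : ∀ k, |f / N * ∑ j, G k j| ≤ f * σ := by
    intro k
    rw [abs_mul, abs_of_nonneg (by positivity)]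
    calc f / N * |∑ j, G k j| ≤ f / N * (N * σ) := by gcongr; exact hrow k
      _ = f * σ := by field_simp
  have hD := hX.measure_diag_le hr (d := fun j => G j j) fun j => hG j j
  have hC := hX.measure_chaos_small_le hr hsymm hG hG2
  have hL := hX.measure_linear_le hr (a := q * σ) (g := fun k => f / N * ∑ j, G k j)
    (by positivity) fun k => (hcrow k).trans (by gcongr)
  have hR : μ.real (⋃ k, {ω | 1 / 10 ^ 6 ≤ |∑ j, X j ω * G k j|}) ≤ 2 * N * Real.exp (-K) := by
    refine (measureReal_iUnion_fintype_le _).trans ?_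
    calc _ ≤ ∑ k : ι, 2 * Real.exp (-K) :=
          Finset.sum_le_sum fun k _ => hX.measure_linear_small_le hr (hG k) (hG2 k)
      _ = (Fintype.card ι : ℝ) * (2 * Real.exp (-K)) := by
          rw [Finset.sum_const, Finset.card_univ, nsmul_eq_mul]
      _ ≤ N * (2 * Real.exp (-K)) := by gcongr; exact hX.card_le
      _ = _ := by ring
  have hsum := add_le_add (add_le_add hD hC) (add_le_add hL hR)
  rw [← add_mul, ← add_mul, ← add_mul] at hsum
  refine (measureReal_mono ?_).trans ((measureReal_union_le _ _).trans ((add_le_add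
    (measureReal_union_le _ _) (measureReal_union_le _ _)).trans (hsum.trans ?_)))
  · intro ω hω
    by_contra hcon
    simp only [Set.mem_union, Set.mem_iUnion, Set.mem_ofPred_eq, not_or, not_exists,
      not_le] at hcon
    obtain ⟨⟨c1, c2⟩, c3, c4⟩ := hcon
    refine hω ⟨?_, fun k => ?_⟩
    · rw [shifted_form_eq hsymm, sum_sum_eq_diag_add_chaos hsymm]
      have e1 : ∑ k, (X k ω ^ 2 - 1 / N) * G k k
          = ∑ j, G j j * X j ω ^ 2 - 1 / N * ∑ j, G j j := by
        rw [Finset.mul_sum, ← Finset.sum_sub_distrib]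
        exact Finset.sum_congr rfl fun k _ => by ring
      have e2 : |f / N * (f / N * ∑ k, ∑ j, G k j)| ≤ f * (f * σ) := by
        rw [Finset.mul_sum, abs_mul, abs_of_nonneg (by positivity)]
        calc f / N * |∑ k, f / N * ∑ j, G k j| ≤ f / N * ∑ k : ι, f * σ := by
              gcongr
              exact (Finset.abs_sum_le_sum_abs _ _).trans (Finset.sum_le_sum fun k _ => hcrow k)
          _ = (Fintype.card ι : ℝ) * (f / N * (f * σ)) := by
              rw [Finset.sum_const, Finset.card_univ, nsmul_eq_mul]; ring
          _ ≤ N * (f / N * (f * σ)) := by gcongr; exact hX.card_le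
          _ = f * (f * σ) := by field_simp
      rw [e1] at c1
      rw [abs_lt] at c1 c2 c3
      rw [abs_le] at e2 ⊢
      constructor <;> linarith
    · have e3 : ∑ j, (X j ω + f / N) * G j k = ∑ j, X j ω * G k j + f / N * ∑ j, G k j := by
        rw [Finset.mul_sum, ← Finset.sum_add_distrib]
        exact Finset.sum_congr rfl fun j _ => by rw [hsymm j k]; ring
      rw [e3]
      have := hcrow k
      refine (abs_add_le _ _).trans ?_
      linarith [c4 k]
  · exact mul_le_mul_of_nonneg_right (by linarith [hr.one_le_N]) (Real.exp_nonneg _)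

/-- Concentration of complex quadratic forms of a shifted sparse vector. -/
theorem measure_shifted_form_complex_le (hX : IsSparseFamily μ N q X)
    (hr : SparseRegime N q ℓ K) {f : ℝ} (hf0 : 0 ≤ f) (hfq : f ≤ q) {G : ι → ι → ℂ}
    (hsymm : ∀ j k, G j k = G k j) (hG : ∀ j k, ‖G j k‖ ≤ 84)
    (hG2 : ∀ j, ∑ k, ‖G j k‖ ^ 2 ≤ N * (100 * Real.exp (-ℓ))) :
    μ.real {ω | ¬ (‖∑ k, (∑ j, ((X j ω + f / N : ℝ) : ℂ) * G j k) * ((X k ω + f / N : ℝ) : ℂ)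
          - 1 / (N : ℂ) * ∑ j, G j j‖ ≤ 1 / 10 ^ 5 ∧
        ∀ k, ‖∑ j, ((X j ω + f / N : ℝ) : ℂ) * G j k‖ ≤ 1 / 10 ^ 5)}
      ≤ 32 * N * Real.exp (-K) := by
  have hre := hX.measure_shifted_form_le hr hf0 hfq (G := fun j k => (G j k).re)
    (fun j k => by rw [hsymm]) (fun j k => (Complex.abs_re_le_norm _).trans (hG j k))
    (fun j => (Finset.sum_le_sum fun k _ => by
      rw [← sq_abs]; gcongr; exact Complex.abs_re_le_norm _).trans (hG2 j))
  have him := hX.measure_shifted_form_le hr hf0 hfq (G := fun j k => (G j k).im)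
    (fun j k => by rw [hsymm]) (fun j k => (Complex.abs_im_le_norm _).trans (hG j k))
    (fun j => (Finset.sum_le_sum fun k _ => by
      rw [← sq_abs]; gcongr; exact Complex.abs_im_le_norm _).trans (hG2 j))
  refine (measureReal_mono ?_).trans ((measureReal_union_le _ _).trans
    ((add_le_add hre him).trans (le_of_eq (by ring))))
  intro ω hω
  by_contra hcon
  simp only [Set.mem_union, Set.mem_ofPred_eq, not_or, not_not] at hcon
  obtain ⟨⟨r1, r2⟩, i1, i2⟩ := hcon
  have hN1 : (1 / (N : ℂ)) = ((1 / N : ℝ) : ℂ) := by push_cast; rfl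
  refine hω ⟨(Complex.norm_le_abs_re_add_abs_im _).trans ?_,
    fun k => (Complex.norm_le_abs_re_add_abs_im _).trans ?_⟩
  · rw [hN1]
    simp only [Complex.sub_re, Complex.sub_im, Complex.re_sum, Complex.im_sum,
      Complex.re_mul_ofReal, Complex.im_mul_ofReal, Complex.re_ofReal_mul, Complex.im_ofReal_mul]
    linarith
  · simp only [Complex.re_sum, Complex.im_sum, Complex.re_ofReal_mul, Complex.im_ofReal_mul]
    linarith [r2 k, i2 k]

end IsSparseFamily

end ShiftedForm

/-! ### Rows of sparse random matrices -/

section Model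

variable {Ω : Type*} [MeasurableSpace Ω] {μ : Measure Ω}

/-- Markov's inequality for the `k`-th power gives `P(|Y| ≥ c/q) ≤ C c^(-k)`. Let `k → ∞` for fixed
`c > 1`, then `c → 1` along a sequence. -/
theorem ae_abs_le_of_moments [IsProbabilityMeasure μ] {Y : Ω → ℝ} {q C : ℝ} (hq : 0 < q)
    (hint : ∀ k : ℕ, Integrable (fun ω => |Y ω| ^ k) μ)
    (hmom : ∀ k : ℕ, 3 ≤ k → ∫ ω, |Y ω| ^ k ∂μ ≤ C / q ^ k) : ∀ᵐ ω ∂μ, |Y ω| ≤ 1 / q := by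
  have hc : ∀ c : ℝ, 1 < c → ∀ᵐ ω ∂μ, |Y ω| < c / q := by
    intro c hc
    have hc0 : 0 < c := by linarith
    have h1 : ∀ k : ℕ, 3 ≤ k → μ.real {ω | c / q ≤ |Y ω|} ≤ C * (1 / c) ^ k := by
      intro k hk
      have h2 := mul_meas_ge_le_integral_of_nonneg
        (Filter.Eventually.of_forall fun ω => by positivity) (hint k) ((c / q) ^ k)
      have h3 : {ω | c / q ≤ |Y ω|} ⊆ {ω | (c / q) ^ k ≤ |Y ω| ^ k} := fun ω (hω : c / q ≤ |Y ω|) =>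
        pow_le_pow_left₀ (by positivity) hω k
      have h4 : (c / q) ^ k * μ.real {ω | c / q ≤ |Y ω|} ≤ C / q ^ k :=
        (mul_le_mul_of_nonneg_left (measureReal_mono h3) (by positivity)).trans
          (h2.trans (hmom k hk))
      have h5 : (c / q) ^ k * (C * (1 / c) ^ k) = C / q ^ k := by
        rw [div_pow, div_pow, one_pow]; field_simp
      rw [← h5] at h4
      exact le_of_mul_le_mul_left h4 (by positivity)
    have h6 : Filter.Tendsto (fun k : ℕ => C * (1 / c) ^ k) Filter.atTop (nhds (C * 0)) :=
      (tendsto_pow_atTop_nhds_zero_of_lt_one (by positivity)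
        ((div_lt_one hc0).mpr hc)).const_mul C
    rw [mul_zero] at h6
    have h7 : μ.real {ω | c / q ≤ |Y ω|} ≤ 0 :=
      ge_of_tendsto h6 (Filter.eventually_atTop.mpr ⟨3, h1⟩)
    have h8 : μ {ω | c / q ≤ |Y ω|} = 0 :=
      (measureReal_eq_zero_iff).mp (le_antisymm h7 measureReal_nonneg)
    rw [ae_iff]
    simpa using h8
  have hall : ∀ᵐ ω ∂μ, ∀ n : ℕ, |Y ω| < (1 + 1 / ((n : ℝ) + 1)) / q :=
    ae_all_iff.mpr fun n => hc _ (by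
      have : (0 : ℝ) < 1 / ((n : ℝ) + 1) := by positivity
      linarith)
  filter_upwards [hall] with ω hω
  have hlim : Filter.Tendsto (fun n : ℕ => (1 + 1 / ((n : ℝ) + 1)) / q) Filter.atTop
      (nhds ((1 + 0) / q)) :=
    (tendsto_const_nhds.add tendsto_one_div_add_atTop_nhds_zero_nat).div_const q
  rw [add_zero] at hlim
  exact ge_of_tendsto' hlim fun n => (hω n).le

variable {N : ℕ} {q K₀ : ℝ} {H : Ω → Matrix (Fin N) (Fin N) ℝ}

namespace IsSparseMatrix

variable [IsProbabilityMeasure μ]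

theorem ae_abs_le (hH : IsSparseMatrix μ q K₀ H) (i j : Fin N) :
    ∀ᵐ ω ∂μ, |H ω i j| ≤ 1 / q := by
  refine ae_abs_le_of_moments (C := q ^ 2 / N) hH.q_pos (fun k => hH.integrable k i j)
    fun k hk => (hH.moment k hk i j).trans (le_of_eq ?_)
  obtain ⟨m, rfl⟩ := Nat.exists_eq_add_of_le (show 2 ≤ k by omega)
  have := hH.q_pos
  rw [Nat.add_sub_cancel_left, pow_add]
  field_simp

/-- The position of the entry `(i, j)` in the upper triangle. -/
def upperIndex (i j : Fin N) : {e : Fin N × Fin N // e.1 ≤ e.2} :=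
  ⟨(min i j, max i j), min_le_max⟩

omit [IsProbabilityMeasure μ] in
theorem apply_upperIndex (hH : IsSparseMatrix μ q K₀ H) (ω : Ω) (i j : Fin N) :
    H ω (upperIndex i j).1.1 (upperIndex i j).1.2 = H ω i j := by
  rcases le_total i j with h | h
  · simp [upperIndex, h]
  · simpa [upperIndex, h] using (hH.symm ω).apply i j

theorem row_isSparseFamily (hH : IsSparseMatrix μ q K₀ H) (i : Fin N) :
    IsSparseFamily μ (N : ℝ) q (fun (j : {j // j ≠ i}) ω => H ω i j) where
  measurable j := hH.measurable i j
  indep := by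
    have hinj : Function.Injective fun j : {j // j ≠ i} => upperIndex i (j : Fin N) := by
      intro j k h
      have h1 : min i (j : Fin N) = min i k := congrArg (fun e => e.1.1) h
      have h2 : max i (j : Fin N) = max i k := congrArg (fun e => e.1.2) h
      have := j.2
      have := k.2
      apply Subtype.ext
      grind
    have := hH.indep.precomp hinj
    simpa only [Function.comp_def, hH.apply_upperIndex] using this
  bounded j := hH.ae_abs_le i j
  mean j := hH.mean i j
  variance j := hH.variance_offDiag i j j.2.symm
  card_le := by
    have := Fintype.card_subtype_le fun j : Fin N => j ≠ i
    rw [Fintype.card_fin] at this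
    exact_mod_cast this

omit [IsProbabilityMeasure μ] in
-- The minor reads upper-triangular entries with both indices different from `i`, the row reads
-- entries with an index equal to `i`: disjoint subfamilies of an independent family.
theorem indepFun_minor_row (hH : IsSparseMatrix μ q K₀ H) (i : Fin N) :
    IndepFun (fun ω (j k : {j // j ≠ i}) => H ω j k) (fun ω (j : {j // j ≠ i}) => H ω i j) μ := by
  classical
  let S : Finset {e : Fin N × Fin N // e.1 ≤ e.2} := Finset.univ.filter fun e => e.1.1 ≠ i ∧ e.1.2 ≠ i
  let T : Finset {e : Fin N × Fin N // e.1 ≤ e.2} :=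
    Finset.univ.filter fun e => ¬ (e.1.1 ≠ i ∧ e.1.2 ≠ i)
  have hST : Disjoint S T := Finset.disjoint_filter_filter_not _ _ _
  have h := hH.indep.indepFun_finset S T hST fun e => hH.measurable _ _
  have hS : ∀ j k : {j // j ≠ i}, upperIndex (j : Fin N) (k : Fin N) ∈ S := by
    intro j k
    simp only [S, Finset.mem_filter, Finset.mem_univ, true_and, upperIndex]
    rcases le_total (j : Fin N) (k : Fin N) with h | h <;> simp [h, j.2, k.2]
  have hT : ∀ j : {j // j ≠ i}, upperIndex i (j : Fin N) ∈ T := by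
    intro j
    simp only [T, Finset.mem_filter, Finset.mem_univ, true_and, upperIndex]
    rcases le_total i (j : Fin N) with h | h <;> simp [h]
  have h2 := h.comp
    (φ := fun y (j k : {j // j ≠ i}) => y ⟨upperIndex (j : Fin N) (k : Fin N), hS j k⟩)
    (ψ := fun y (j : {j // j ≠ i}) => y ⟨upperIndex i (j : Fin N), hT j⟩)
    (by fun_prop) (by fun_prop)
  simpa only [Function.comp_def, hH.apply_upperIndex] using h2

end IsSparseMatrix

theorem adjacencyMatrix_apply (f : ℝ) (H : Matrix (Fin N) (Fin N) ℝ) (i j : Fin N) :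
    adjacencyMatrix f H i j = H i j + f / N := by
  have hN : (0 : ℝ) < N := by exact_mod_cast i.pos
  simp only [adjacencyMatrix, Matrix.add_apply, Matrix.smul_apply, Matrix.vecMulVec_apply,
    flatVector, smul_eq_mul]
  rw [← Real.rpow_add hN]
  norm_num
  rw [Real.rpow_neg_one]
  rfl

theorem adjacencyMatrix_isSymm (f : ℝ) {H : Matrix (Fin N) (Fin N) ℝ} (hH : H.IsSymm) :
    (adjacencyMatrix f H).IsSymm := by
  ext i j
  rw [Matrix.transpose_apply, adjacencyMatrix_apply, adjacencyMatrix_apply, hH.apply i j]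

/-- Cramer's formula; `det⁻¹` is measurable even where the determinant vanishes, so `M` need be
neither symmetric nor invertible after the shift. -/
theorem measurable_greenFunction {κ : Type*} [Fintype κ] [DecidableEq κ] (c : ℝ) (z : ℂ)
    (j k : κ) :
    Measurable fun M : κ → κ → ℝ => greenFunction (Matrix.of fun a b => M a b + c) z j k := by
  have hcont : Continuous fun M : κ → κ → ℝ =>
      spectralShift (Matrix.of fun a b => M a b + c) z := by
    refine continuous_matrix fun a b => ?_
    simp only [spectralShift, Matrix.sub_apply, Matrix.map_apply, Matrix.of_apply]
    fun_prop
  have h1 : (fun M : κ → κ → ℝ => greenFunction (Matrix.of fun a b => M a b + c) z j k)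
      = fun M => (spectralShift (Matrix.of fun a b => M a b + c) z).det⁻¹
        * (spectralShift (Matrix.of fun a b => M a b + c) z).adjugate j k := by
    funext M
    rw [greenFunction, Matrix.inv_def, Matrix.smul_apply, Ring.inverse_eq_inv', smul_eq_mul]
  rw [h1]
  exact hcont.matrix_det.measurable.inv.mul
    ((continuous_apply_apply j k).comp hcont.matrix_adjugate).measurable

variable {ℓ K : ℝ}

/-- With overwhelming probability a row is concentrated, if the Green function of the minor is
bounded. -/
theorem IsSparseMatrix.measure_not_rowConcentrated_le [IsProbabilityMeasure μ]
    (hH : IsSparseMatrix μ q K₀ H) (hr : SparseRegime (N : ℝ) q ℓ K) {f : ℝ} (hf0 : 0 ≤ f)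
    (hfq : f ≤ q) {z : ℂ} (hz : Real.exp ℓ / N ≤ z.im) (i : Fin N) :
    μ.real {ω | (∀ j k, ‖greenFunction (minor (adjacencyMatrix f (H ω)) i) z j k‖ ≤ 84) ∧
        ¬ RowConcentrated (adjacencyMatrix f (H ω)) z i (1 / 10 ^ 5)}
      ≤ 32 * N * Real.exp (-K) := by
  have hN := hr.N_pos
  have hz0 : 0 < z.im := lt_of_lt_of_le (by positivity) hz
  let G : ({j // j ≠ i} → {j // j ≠ i} → ℝ) → Matrix {j // j ≠ i} {j // j ≠ i} ℂ :=
    fun M => greenFunction (Matrix.of fun a b => M a b + f / N) z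
  have hGm : ∀ j k, Measurable fun M => G M j k := fun j k => measurable_greenFunction _ _ _ _
  let S : Set (({j // j ≠ i} → {j // j ≠ i} → ℝ) × ({j // j ≠ i} → ℝ)) :=
    {p | (∀ j k, ‖G p.1 j k‖ ≤ 84) ∧
      ¬ (‖∑ k, (∑ j, ((p.2 j + f / N : ℝ) : ℂ) * G p.1 j k) * ((p.2 k + f / N : ℝ) : ℂ)
          - 1 / ((N : ℝ) : ℂ) * ∑ j, G p.1 j j‖ ≤ 1 / 10 ^ 5 ∧
        ∀ k, ‖∑ j, ((p.2 j + f / N : ℝ) : ℂ) * G p.1 j k‖ ≤ 1 / 10 ^ 5)}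
  have hGm' : ∀ j k, Measurable fun p : ({j // j ≠ i} → {j // j ≠ i} → ℝ) × ({j // j ≠ i} → ℝ) =>
      G p.1 j k := fun j k => (hGm j k).comp measurable_fst
  have hxm : ∀ j, Measurable fun p : ({j // j ≠ i} → {j // j ≠ i} → ℝ) × ({j // j ≠ i} → ℝ) =>
      ((p.2 j + f / N : ℝ) : ℂ) := fun j => by fun_prop
  have hsum : ∀ k, Measurable fun p : ({j // j ≠ i} → {j // j ≠ i} → ℝ) × ({j // j ≠ i} → ℝ) =>
      ∑ j, ((p.2 j + f / N : ℝ) : ℂ) * G p.1 j k := fun k =>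
    Finset.measurable_fun_sum _ fun j _ => (hxm j).mul (hGm' j k)
  have hS : MeasurableSet S := by
    have m1 : MeasurableSet {p : ({j // j ≠ i} → {j // j ≠ i} → ℝ) × ({j // j ≠ i} → ℝ) |
        ∀ j k, ‖G p.1 j k‖ ≤ 84} := by
      simp only [Set.ofPred_forall]
      exact .iInter fun j => .iInter fun k => measurableSet_le (hGm' j k).norm measurable_const
    have m2 : MeasurableSet {p : ({j // j ≠ i} → {j // j ≠ i} → ℝ) × ({j // j ≠ i} → ℝ) |
        ‖∑ k, (∑ j, ((p.2 j + f / N : ℝ) : ℂ) * G p.1 j k) * ((p.2 k + f / N : ℝ) : ℂ)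
          - 1 / ((N : ℝ) : ℂ) * ∑ j, G p.1 j j‖ ≤ 1 / 10 ^ 5} :=
      measurableSet_le (((Finset.measurable_fun_sum _ fun k _ => (hsum k).mul (hxm k)).sub
        ((Finset.measurable_fun_sum _ fun j _ => hGm' j j).const_mul _)).norm) measurable_const
    have m3 : MeasurableSet {p : ({j // j ≠ i} → {j // j ≠ i} → ℝ) × ({j // j ≠ i} → ℝ) |
        ∀ k, ‖∑ j, ((p.2 j + f / N : ℝ) : ℂ) * G p.1 j k‖ ≤ 1 / 10 ^ 5} := by
      simp only [Set.ofPred_forall]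
      exact .iInter fun k => measurableSet_le (hsum k).norm measurable_const
    exact m1.inter (m2.inter m3).compl
  let Y : Ω → {j // j ≠ i} → {j // j ≠ i} → ℝ := fun ω j k => H ω j k
  let X : Ω → {j // j ≠ i} → ℝ := fun ω j => H ω i j
  have hY : Measurable Y := measurable_pi_lambda _ fun j => measurable_pi_lambda _ fun k =>
    hH.measurable _ _
  have hX : Measurable X := measurable_pi_lambda _ fun j => hH.measurable _ _
  have hminor : ∀ ω, minor (adjacencyMatrix f (H ω)) i = Matrix.of fun a b => Y ω a b + f / N := by
    intro ω
    ext a b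
    simp [minor, adjacencyMatrix_apply, Y]
  have hset : {ω | (∀ j k, ‖greenFunction (minor (adjacencyMatrix f (H ω)) i) z j k‖ ≤ 84) ∧
        ¬ RowConcentrated (adjacencyMatrix f (H ω)) z i (1 / 10 ^ 5)}
      = (fun ω => (Y ω, X ω)) ⁻¹' S := by
    ext ω
    simp only [RowConcentrated, minorRow, hminor, adjacencyMatrix_apply, Fintype.card_fin]
    rfl
  -- Freeze the minor. If its Green function exceeds 84 the event is empty; otherwise Ward at `Im z
  -- ≥ e^ℓ / N` supplies the row bound `84 N e^(-ℓ)`.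
  have hfix : ∀ ω, μ {ω' | (Y ω, X ω') ∈ S} ≤ ENNReal.ofReal (32 * N * Real.exp (-K)) := by
    intro ω
    by_cases hb : ∀ j k, ‖G (Y ω) j k‖ ≤ 84
    · have hsymm : (Matrix.of fun a b => Y ω a b + f / N).IsSymm := by
        rw [← hminor]; exact minor_isSymm (adjacencyMatrix_isSymm f (hH.symm ω)) i
      have h := (hH.row_isSparseFamily i).measure_shifted_form_complex_le hr hf0 hfq
        (G := fun j k => G (Y ω) j k) (fun j k => greenFunction_comm hsymm z j k) hb (fun j => by
          refine (sum_norm_sq_greenFunction_le hsymm hz0 j).trans ?_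
          calc _ ≤ 84 / (Real.exp ℓ / N) := by gcongr; exact hb j j
            _ = N * (84 * Real.exp (-ℓ)) := by rw [Real.exp_neg]; field_simp
            _ ≤ _ := by gcongr; norm_num)
      rw [← ENNReal.ofReal_toReal (measure_ne_top μ {ω' | (Y ω, X ω') ∈ S})]
      refine ENNReal.ofReal_le_ofReal (le_trans ?_ h)
      exact measureReal_mono fun ω' hω' => hω'.2
    · have : {ω' | (Y ω, X ω') ∈ S} = ∅ := by
        ext ω'
        simp only [Set.mem_empty_iff_false, iff_false]
        exact fun h => hb h.1
      rw [this, measure_empty]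
      exact zero_le
  have hmain : μ ((fun ω => (Y ω, X ω)) ⁻¹' S) ≤ ENNReal.ofReal (32 * N * Real.exp (-K)) := by
    have h1 := lintegral_comp_prodMk_of_indepFun hY hX (hH.indepFun_minor_row i)
      (h := S.indicator fun _ => 1) (measurable_const.indicator hS)
    have h2 : ∀ ω, ∫⁻ ω', S.indicator (fun _ => (1 : ENNReal)) (Y ω, X ω') ∂μ
        = μ {ω' | (Y ω, X ω') ∈ S} := by
      intro ω
      have : (fun ω' => S.indicator (fun _ => (1 : ENNReal)) (Y ω, X ω'))
          = {ω' | (Y ω, X ω') ∈ S}.indicator 1 := rfl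
      rw [this, lintegral_indicator_one]
      exact (measurable_const.prodMk hX) hS
    have h3 : ∫⁻ ω, S.indicator (fun _ => (1 : ENNReal)) (Y ω, X ω) ∂μ
        = μ ((fun ω => (Y ω, X ω)) ⁻¹' S) := by
      have : (fun ω => S.indicator (fun _ => (1 : ENNReal)) (Y ω, X ω))
          = ((fun ω => (Y ω, X ω)) ⁻¹' S).indicator 1 := rfl
      rw [this, lintegral_indicator_one]
      exact (hY.prodMk hX) hS
    rw [← h3, h1]
    simp_rw [h2]
    calc _ ≤ ∫⁻ _, ENNReal.ofReal (32 * N * Real.exp (-K)) ∂μ := lintegral_mono hfix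
      _ = _ := by simp
  rw [hset]
  exact ENNReal.toReal_le_of_le_ofReal (by positivity) hmain

end Model

/-! ### Delocalization -/

section Delocalization

variable {N : ℕ}

/-- The spectral scale `2 ^ m e ^ ℓ / N`. -/
noncomputable def spectralScale (N : ℕ) (ℓ : ℝ) (m : ℕ) : ℝ := 2 ^ m * (Real.exp ℓ / N)

/-- The rows of `A` are concentrated at the spectral parameter `z`, as far as needed. -/
def Concentrated (A : Matrix (Fin N) (Fin N) ℝ) (z : ℂ) : Prop :=
  ∀ i, (∀ j k, ‖greenFunction (minor A i) z j k‖ ≤ 84) → RowConcentrated A z i (1 / 10 ^ 5)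

/-- `N` doublings certainly reach `η ≥ 2`, since `2^N ≥ N`. This is far more than necessary but
costs only a factor `N` in the union bound. -/
theorem greenBounded_of_concentrated (hN : 10 ^ 6 ≤ N) {ℓ : ℝ} (hℓ : 1 ≤ ℓ)
    {A : Matrix (Fin N) (Fin N) ℝ} (hA : A.IsSymm) (hd : ∀ i, |A i i| ≤ 1 / 10 ^ 5) {E : ℝ}
    (hconc : ∀ m < N, Concentrated A ⟨E, spectralScale N ℓ m⟩) :
    GreenBounded A ⟨E, spectralScale N ℓ 0⟩ (energyBound E) := by
  have hNpos : (0 : ℝ) < N := by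
    have : 0 < N := by omega
    exact_mod_cast this
  have htop : 2 ≤ spectralScale N ℓ N := by
    have h1 : (N : ℝ) ≤ 2 ^ N := by exact_mod_cast (Nat.lt_two_pow_self (n := N)).le
    have h2 : 2 ≤ Real.exp ℓ := by linarith [Real.add_one_le_exp ℓ]
    calc (2 : ℝ) ≤ Real.exp ℓ := h2
      _ = N * (Real.exp ℓ / N) := by field_simp
      _ ≤ 2 ^ N * (Real.exp ℓ / N) := by gcongr
  have hstep : ∀ m < N, GreenBounded A ⟨E, spectralScale N ℓ (m + 1)⟩ (energyBound E) →
      GreenBounded A ⟨E, spectralScale N ℓ m⟩ (energyBound E) := by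
    intro m hm h
    have hpos : 0 < spectralScale N ℓ m := by unfold spectralScale; positivity
    rcases le_or_gt 2 (spectralScale N ℓ m) with h2 | h2
    · exact greenBounded_top hA h2
    · refine greenBounded_step hA hpos h2.le (by simpa using hN) hd ?_ (hconc m hm)
      have : spectralScale N ℓ (m + 1) = 2 * spectralScale N ℓ m := by
        unfold spectralScale; ring
      rwa [this] at h
  exact Nat.decreasingInduction (motive := fun m _ =>
    GreenBounded A ⟨E, spectralScale N ℓ m⟩ (energyBound E)) (fun m hm => hstep m hm)
    (greenBounded_top hA htop) (Nat.zero_le N)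

theorem abs_eigenvalue_le {A : Matrix (Fin N) (Fin N) ℝ} {a : ℝ} (hA : ∀ i j, |A i j| ≤ a)
    {u : Fin N → ℝ} (hu : u ≠ 0) {l : ℝ} (hl : A.mulVec u = l • u) : |l| ≤ N * a := by
  obtain ⟨i, hi⟩ := Function.ne_iff.mp hu
  obtain ⟨k, -, hk⟩ := Finset.exists_max_image Finset.univ (fun k => |u k|) ⟨i, Finset.mem_univ i⟩
  have hk0 : 0 < |u k| := (abs_pos.mpr hi).trans_le (hk i (Finset.mem_univ i))
  refine le_of_mul_le_mul_right ?_ hk0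
  have h1 : l * u k = ∑ j, A k j * u j := by
    have := congrFun hl k
    simpa [Matrix.mulVec, dotProduct] using this.symm
  rw [← abs_mul, h1]
  calc |∑ j, A k j * u j| ≤ ∑ j : Fin N, a * |u k| := by
        refine (Finset.abs_sum_le_sum_abs _ _).trans (Finset.sum_le_sum fun j _ => ?_)
        rw [abs_mul]
        exact mul_le_mul (hA k j) (hk j (Finset.mem_univ j)) (abs_nonneg _)
          ((abs_nonneg _).trans (hA k j))
    _ = N * a * |u k| := by simp; ring

/-- The energies `k / N` with `|k| ≤ 2 N ^ 2`. -/
noncomputable def energyGrid (N : ℕ) : Finset ℤ := Finset.Icc (-(2 * (N : ℤ) ^ 2)) (2 * (N : ℤ) ^ 2)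

/-- Eigenvectors are delocalized when all rows are concentrated on the energy grid. -/
theorem eigenvector_sq_le_of_concentrated (hN : 10 ^ 6 ≤ N) {ℓ : ℝ} (hℓ : 1 ≤ ℓ)
    {A : Matrix (Fin N) (Fin N) ℝ} (hA : A.IsSymm) (hd : ∀ i, |A i i| ≤ 1 / 10 ^ 5)
    (hA2 : ∀ i j, |A i j| ≤ 2)
    (hconc : ∀ e ∈ energyGrid N, ∀ m < N,
      Concentrated A ⟨(e : ℝ) / N, spectralScale N ℓ m⟩)
    {u : Fin N → ℝ} (hu : ∑ i, u i ^ 2 = 1) {l : ℝ} (hl : A.mulVec u = l • u) (k : Fin N) :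
    u k ^ 2 ≤ 84 * (Real.exp ℓ / N) := by
  have hNpos : (0 : ℝ) < N := by exact_mod_cast k.pos
  have hu0 : u ≠ 0 := by
    rintro rfl
    simp at hu
  have hlN := abs_eigenvalue_le hA2 hu0 hl
  have hη : 0 < spectralScale N ℓ 0 := by unfold spectralScale; positivity
  have hη1 : 1 / N ≤ spectralScale N ℓ 0 := by
    unfold spectralScale
    rw [pow_zero, one_mul]
    gcongr
    exact Real.one_le_exp (by linarith)
  -- Since `|l| ≤ 2N`, rounding `l` down to a multiple of `1/N` stays in the grid and moves it by at
  -- most `1/N ≤ η`.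
  have hmem : ⌊l * N⌋ ∈ energyGrid N := by
    rw [abs_le] at hlN
    rw [energyGrid, Finset.mem_Icc]
    constructor
    · rw [Int.le_floor]
      push_cast
      nlinarith
    · have : ((⌊l * N⌋ : ℤ) : ℝ) ≤ ((2 * (N : ℤ) ^ 2 : ℤ) : ℝ) := by
        refine (Int.floor_le _).trans ?_
        push_cast
        nlinarith
      exact_mod_cast this
  set E : ℝ := (⌊l * N⌋ : ℝ) / N with hE
  have hEl : |l - E| ≤ spectralScale N ℓ 0 := by
    refine le_trans ?_ hη1
    have h1 := Int.floor_le (l * N)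
    have h2 := Int.lt_floor_add_one (l * N)
    have h3 : l - E = (l * N - ⌊l * N⌋) / N := by rw [hE]; field_simp
    rw [h3, abs_of_nonneg (div_nonneg (by linarith) hNpos.le)]
    gcongr
    linarith
  have hB := (greenBounded_of_concentrated hN hℓ hA hd (hconc _ hmem)).1 k k
  set η := spectralScale N ℓ 0 with hηdef
  have h4 := eigenvector_sq_le hA (z := ⟨E, η⟩) hη hu hl k
  have h5 : ‖(l : ℂ) - ⟨E, η⟩‖ ^ 2 ≤ 2 * η ^ 2 := by
    rw [← Complex.normSq_eq_norm_sq, Complex.normSq_apply]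
    simp only [Complex.sub_re, Complex.sub_im, Complex.ofReal_re, Complex.ofReal_im]
    have := sq_le_sq' (by linarith [neg_abs_le (l - E)]) ((le_abs_self _).trans hEl)
    nlinarith
  calc u k ^ 2 ≤ ‖(l : ℂ) - ⟨E, η⟩‖ ^ 2 * (‖greenFunction A ⟨E, η⟩ k k‖ / η) := h4
    _ ≤ 2 * η ^ 2 * (42 / η) := by
        gcongr
        exact hB.trans (energyBound_le E)
    _ = 84 * η := by field_simp; norm_num
    _ = _ := by rw [hηdef, spectralScale]; ring

/-- The constant in `u_k² ≤ 84 e^ℓ / N` is absorbed by a second factor `e^ℓ`, which also makes the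
inequality strict. -/
theorem supNorm_lt_of_concentrated (hN : 10 ^ 6 ≤ N) {ℓ : ℝ} (hℓ : 5 ≤ ℓ)
    {A : Matrix (Fin N) (Fin N) ℝ} (hA : A.IsSymm) (hd : ∀ i, |A i i| ≤ 1 / 10 ^ 5)
    (hA2 : ∀ i j, |A i j| ≤ 2)
    (hconc : ∀ e ∈ energyGrid N, ∀ m < N,
      Concentrated A ⟨(e : ℝ) / N, spectralScale N ℓ m⟩)
    {u : EuclideanSpace ℝ (Fin N)} (hu : IsNormalizedEigenvector A u) :
    supNorm u < Real.exp ℓ / √(N : ℝ) := by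
  obtain ⟨hnorm, l, hl⟩ := hu
  have hNpos : (0 : ℝ) < N := by
    have : 0 < N := by omega
    exact_mod_cast this
  have hu1 : ∑ i, (WithLp.ofLp u) i ^ 2 = 1 := by
    have := EuclideanSpace.real_norm_sq_eq u
    rw [hnorm, one_pow] at this
    exact this.symm
  have hlu : A.mulVec (WithLp.ofLp u) = l • WithLp.ofLp u := by
    have := congrArg WithLp.ofLp hl.apply_eq_smul
    simpa using this
  have hexp : 84 < Real.exp ℓ := by
    have h1 : Real.exp 5 ≤ Real.exp ℓ := Real.exp_le_exp.mpr hℓ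
    have h2 : Real.exp 5 = Real.exp 1 ^ 5 := by rw [← Real.exp_nat_mul]; norm_num
    have h3 : (2.7 : ℝ) ^ 5 ≤ Real.exp 1 ^ 5 := by
      gcongr
      linarith [Real.exp_one_gt_d9]
    have h4 : (84 : ℝ) < 2.7 ^ 5 := by norm_num
    linarith
  rw [supNorm, pi_norm_lt_iff (by positivity)]
  intro k
  rw [Real.norm_eq_abs]
  refine abs_lt_of_sq_lt_sq ?_ (by positivity)
  calc u k ^ 2 ≤ 84 * (Real.exp ℓ / N) :=
        eigenvector_sq_le_of_concentrated hN (by linarith) hA hd hA2 hconc hu1 hlu k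
    _ < Real.exp ℓ * (Real.exp ℓ / N) := by gcongr
    _ = (Real.exp ℓ / √(N : ℝ)) ^ 2 := by
        rw [div_pow, Real.sq_sqrt hNpos.le]; ring

variable {Ω : Type*} [MeasurableSpace Ω] {μ : Measure Ω} [IsProbabilityMeasure μ]

/-- Complete delocalization of the eigenvectors with explicit scales. -/
theorem measure_localized_le {q K₀ ℓ K : ℝ} {H : Ω → Matrix (Fin N) (Fin N) ℝ}
    (hH : IsSparseMatrix μ q K₀ H) (hr : SparseRegime (N : ℝ) q ℓ K) (hN : 10 ^ 6 ≤ N) {f : ℝ}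
    (hf0 : 0 ≤ f) (hfq : f ≤ q) :
    μ.real {ω | ∃ u : EuclideanSpace ℝ (Fin N),
        IsNormalizedEigenvector (adjacencyMatrix f (H ω)) u ∧
        Real.exp ℓ / √(N : ℝ) ≤ supNorm u}
      ≤ 160 * (N : ℝ) ^ 5 * Real.exp (-K) := by
  have hNpos := hr.N_pos
  have hq := hr.q_pos
  let bad : ℤ → ℕ → Fin N → Set Ω := fun e m i =>
    {ω | (∀ j k, ‖greenFunction (minor (adjacencyMatrix f (H ω)) i)
          ⟨(e : ℝ) / N, spectralScale N ℓ m⟩ j k‖ ≤ 84) ∧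
        ¬ RowConcentrated (adjacencyMatrix f (H ω)) ⟨(e : ℝ) / N, spectralScale N ℓ m⟩ i
          (1 / 10 ^ 5)}
  have hbad : ∀ e m i, μ.real (bad e m i) ≤ 32 * N * Real.exp (-K) := by
    intro e m i
    refine hH.measure_not_rowConcentrated_le hr hf0 hfq ?_ i
    change Real.exp ℓ / N ≤ 2 ^ m * (Real.exp ℓ / N)
    exact le_mul_of_one_le_left (by positivity) (one_le_pow₀ (by norm_num))
  let Bad : Set Ω := ⋃ e ∈ energyGrid N, ⋃ m ∈ Finset.range N, ⋃ i, bad e m i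
  have hBad : μ.real Bad ≤ 160 * (N : ℝ) ^ 5 * Real.exp (-K) := by
    have hcard : ((energyGrid N).card : ℝ) = 4 * (N : ℝ) ^ 2 + 1 := by
      have h1 : ((energyGrid N).card : ℤ) = 4 * (N : ℤ) ^ 2 + 1 := by
        rw [energyGrid, Int.card_Icc, Int.toNat_of_nonneg (by linarith [sq_nonneg (N : ℤ)])]
        ring
      exact_mod_cast h1
    have hN1 : (1 : ℝ) ≤ (N : ℝ) ^ 2 := one_le_pow₀ hr.one_le_N
    -- The grid has `4N² + 1 ≤ 5N²` energies; with `N` scales, `N` rows and `32 N e^(-K)` each, the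
    -- total is `160 N⁵ e^(-K)`.
    calc μ.real Bad
        ≤ ∑ e ∈ energyGrid N, ∑ m ∈ Finset.range N, ∑ i, μ.real (bad e m i) := by
          refine (measureReal_biUnion_finset_le _ _).trans (Finset.sum_le_sum fun e _ => ?_)
          refine (measureReal_biUnion_finset_le _ _).trans (Finset.sum_le_sum fun m _ => ?_)
          exact measureReal_iUnion_fintype_le _
      _ ≤ ∑ e ∈ energyGrid N, ∑ m ∈ Finset.range N, ∑ i : Fin N, 32 * N * Real.exp (-K) := by
          gcongr
          exact hbad _ _ _
      _ = (4 * (N : ℝ) ^ 2 + 1) * (N * (N * (32 * N * Real.exp (-K)))) := by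
          simp [hcard]
      _ ≤ (4 * (N : ℝ) ^ 2 + (N : ℝ) ^ 2) * (N * (N * (32 * N * Real.exp (-K)))) := by
          gcongr
      _ = _ := by ring
  have hbdd : ∀ᵐ ω ∂μ, ∀ i j, |H ω i j| ≤ 1 / q :=
    ae_all_iff.mpr fun i => ae_all_iff.mpr fun j => hH.ae_abs_le i j
  have hq9 : (10 : ℝ) ^ 9 ≤ q := by
    refine le_of_sq_le_sq ?_ hq.le
    nlinarith [hr.le_q_sq, hr.K_large]
  -- From `q < √N` the shift `f / N` is also at most `1 / q`, so almost surely every entry of `A` is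
  -- at most `2 / q`.
  have hqN : q / N ≤ 1 / q := by
    have h1 : q ^ 2 ≤ (N : ℝ) := by
      have := hH.q_lt.le
      calc q ^ 2 ≤ √(N : ℝ) ^ 2 := by gcongr
        _ = (N : ℝ) := Real.sq_sqrt hNpos.le
    rw [div_le_div_iff₀ hNpos hq]
    linarith
  have hq1 : 1 / q ≤ 1 / 10 ^ 9 := by gcongr
  have hnull : μ.real {ω | ¬ ∀ i j, |H ω i j| ≤ 1 / q} = 0 := by
    rw [measureReal_eq_zero_iff]
    exact hbdd
  have hsub : {ω | ∃ u : EuclideanSpace ℝ (Fin N),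
        IsNormalizedEigenvector (adjacencyMatrix f (H ω)) u ∧
        Real.exp ℓ / √(N : ℝ) ≤ supNorm u} ⊆ Bad ∪ {ω | ¬ ∀ i j, |H ω i j| ≤ 1 / q} := by
    rintro ω ⟨u, hu, hsup⟩
    by_contra hcon
    rw [Set.mem_union, not_or] at hcon
    obtain ⟨hnb, hb⟩ := hcon
    simp only [Set.mem_ofPred_eq, not_not] at hb
    have hA : ∀ i j, |adjacencyMatrix f (H ω) i j| ≤ 2 / 10 ^ 9 := by
      intro i j
      rw [adjacencyMatrix_apply]
      have h1 : f / N ≤ q / N := by gcongr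
      have h2 : |f / (N : ℝ)| = f / N := abs_of_nonneg (by positivity)
      refine (abs_add_le _ _).trans ?_
      linarith [hb i j]
    refine absurd hsup (not_le.mpr (supNorm_lt_of_concentrated hN
      (by linarith [hr.ell_large]) (adjacencyMatrix_isSymm f (hH.symm ω))
      (fun i => (hA i i).trans (by norm_num)) (fun i j => (hA i j).trans (by norm_num)) ?_ hu))
    intro e he m hm i hi
    by_contra hrow
    exact hnb (Set.mem_biUnion he (Set.mem_biUnion (Finset.mem_coe.mpr (Finset.mem_range.mpr hm))
      (Set.mem_iUnion.mpr ⟨i, hi, hrow⟩)))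
  calc _ ≤ μ.real Bad + μ.real {ω | ¬ ∀ i j, |H ω i j| ≤ 1 / q} :=
        (measureReal_mono hsub).trans (measureReal_union_le _ _)
    _ ≤ _ := by rw [hnull, add_zero]; exact hBad

end Delocalization

/-! ### Numerical constants and the final statement. -/

/-- The hypotheses on `N` and `q` put us in the sparse regime. -/
theorem sparseRegime_of_thresholds {D : ℝ} (hD : 0 < D) {N : ℕ}
    (hN : sizeThreshold (10 ^ 5) 1 D ≤ (N : ℝ)) {q : ℝ}
    (hq : sparsityConstant (10 ^ 5) 1 D * √(Real.log N) ≤ q) (hq2 : q ≤ Real.log N ^ 10) :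
    SparseRegime (N : ℝ) q (√(Real.log N)) ((D + 10) * Real.log N) := by
  set x := 4 * 10 ^ 5 * Real.exp (5 + D) / 1 with hx
  have hexpD : 6 + D ≤ Real.exp (5 + D) := by linarith [Real.add_one_le_exp (5 + D)]
  have hx0 : 4 * 10 ^ 5 * (6 + D) ≤ x := by rw [hx, div_one]; gcongr
  have hxpos : 0 < x := by rw [hx]; positivity
  have hlogx : 5 + D ≤ Real.log x := by
    rw [Real.le_log_iff_exp_le hxpos, hx, div_one]
    exact le_mul_of_one_le_left (Real.exp_nonneg _) (by norm_num)
  have he10 : (20000 : ℝ) ≤ Real.exp 10 := by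
    have h2 : Real.exp 10 = Real.exp 1 ^ 10 := by rw [← Real.exp_nat_mul]; norm_num
    have h3 : (2.7 : ℝ) ^ 10 ≤ Real.exp 1 ^ 10 := by
      gcongr
      linarith [Real.exp_one_gt_d9]
    have h4 : (20000 : ℝ) ≤ 2.7 ^ 10 := by norm_num
    linarith
  have hNpos : (0 : ℝ) < N := (Real.exp_pos _).trans_le hN
  have hlogN : (Real.exp 10 * Real.log x) ^ 2 ≤ Real.log N := by
    rw [Real.le_log_iff_exp_le hNpos]; exact hN
  set ℓ := √(Real.log N) with hℓ
  -- The threshold on `N` enters through `ℓ ≥ e^10 log x ≥ 20000 (5 + D)`, which dominates both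
  -- `10⁵` and `D + 10`.
  have hy : 20000 * (5 + D) ≤ Real.exp 10 * Real.log x := by gcongr
  have hℓ1 : 20000 * (5 + D) ≤ ℓ := by
    refine hy.trans (Real.le_sqrt_of_sq_le hlogN)
  have hℓ5 : 10 ^ 5 ≤ ℓ := by linarith
  have hℓpos : 0 < ℓ := by linarith
  have hL : Real.log N = ℓ ^ 2 := (Real.sq_sqrt ((sq_nonneg _).trans hlogN)).symm
  rw [hL] at hq2 ⊢
  have hC : sparsityConstant (10 ^ 5) 1 D = x ^ 2 := rfl
  rw [hC] at hq
  -- The value `10⁵` of the universal constant makes `C(D) = x²` exceed the `10¹¹ (D + 10)` required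
  -- by both lower bounds on `q`.
  have hx2 : 10 ^ 11 * (D + 10) ≤ x ^ 2 := by
    calc 10 ^ 11 * (D + 10) ≤ (4 * 10 ^ 5 * (6 + D)) ^ 2 := by nlinarith
      _ ≤ x ^ 2 := by gcongr
  have hq3 : 10 ^ 11 * (D + 10) * ℓ ≤ q := le_trans (by gcongr) hq
  have hq1 : 1 ≤ q := by
    refine le_trans ?_ hq3
    nlinarith
  refine ⟨?_, hℓ5, ?_, ?_, hq1, ?_, ?_, ?_⟩
  · exact le_trans (Real.one_le_exp (sq_nonneg _)) hN
  · nlinarith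
  · have : D + 10 ≤ ℓ := by linarith
    calc (D + 10) * ℓ ^ 2 ≤ ℓ * ℓ ^ 2 := by gcongr
      _ = ℓ ^ 3 := by ring
  · calc q ≤ (ℓ ^ 2) ^ 10 := hq2
      _ = ℓ ^ 20 := by ring
  · calc 10 ^ 9 * ((D + 10) * ℓ ^ 2) ≤ 10 ^ 11 * ((D + 10) * ℓ ^ 2) := by gcongr <;> norm_num
      _ = 10 ^ 11 * (D + 10) * ℓ * ℓ := by ring
      _ ≤ q * ℓ := by gcongr
  · calc 10 ^ 18 * ((D + 10) * ℓ ^ 2) ≤ 10 ^ 22 * ((D + 10) * (D + 10) * ℓ ^ 2) := by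
          gcongr
          · norm_num
          · norm_num
          · nlinarith
      _ = (10 ^ 11 * (D + 10) * ℓ) ^ 2 := by ring
      _ ≤ q ^ 2 := by gcongr

theorem theorem2p6 :
    ∃ Cstar : ℝ, 1 ≤ Cstar ∧
      ∀ D : ℝ, 0 < D →
      ∀ N : ℕ, sizeThreshold Cstar 1 D ≤ (N : ℝ) →
      ∀ q : ℝ, sparsityConstant Cstar 1 D * √(Real.log N) ≤ q → q ≤ Real.log N ^ 10 →
      ∀ f : ℝ, 0 ≤ f → f ≤ q →
      ∀ (K : ℝ) (Ω : Type*) [MeasurableSpace Ω] (μ : Measure Ω) [IsProbabilityMeasure μ]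
        (H : Ω → Matrix (Fin N) (Fin N) ℝ), IsSparseMatrix μ q K H →
        μ.real {ω | ∃ u : EuclideanSpace ℝ (Fin N),
            IsNormalizedEigenvector (adjacencyMatrix f (H ω)) u ∧
            (N : ℝ) ^ (Real.log N ^ (-(1 / 2) : ℝ) - 1 / 2 : ℝ) ≤ supNorm u}
          ≤ (N : ℝ) ^ (-D) := by
  refine ⟨10 ^ 5, by norm_num, ?_⟩
  intro D hD N hN q hq hq2 f hf0 hfq K₀ Ω _ μ _ H hH
  have hr := sparseRegime_of_thresholds hD hN hq hq2
  have hNpos := hr.N_pos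
  have hℓpos := hr.ell_pos
  have hLpos : 0 < Real.log N := Real.sqrt_pos.mp hℓpos
  have hL : Real.log N = √(Real.log N) ^ 2 := (Real.sq_sqrt hLpos.le).symm
  have hNexp : Real.exp (Real.log N) = N := Real.exp_log hNpos
  have hN6 : 10 ^ 6 ≤ N := by
    have h1 : (10 ^ 6 : ℝ) ≤ N := by
      rw [← hNexp]
      refine le_trans ?_ (Real.add_one_le_exp _)
      rw [hL]
      nlinarith [hr.ell_large]
    exact_mod_cast h1
  -- `N^((log N)^(-1/2)) = e^(√(log N))`, so the claimed threshold is `e^ℓ / √N`.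
  have hscale : (N : ℝ) ^ (Real.log N ^ (-(1 / 2) : ℝ) - 1 / 2 : ℝ)
      = Real.exp √(Real.log N) / √(N : ℝ) := by
    rw [Real.rpow_sub hNpos, ← Real.sqrt_eq_rpow, Real.rpow_def_of_pos hNpos,
      Real.rpow_neg hLpos.le, ← Real.sqrt_eq_rpow]
    congr 2
    nth_rewrite 1 [hL]
    field_simp
  rw [hscale]
  refine (measure_localized_le hH hr hN6 hf0 hfq).trans ?_
  -- The extra `10` in `K = (D + 10) log N` leaves `N^(-10)` to pay for `160 N⁵`.
  have hexp : Real.exp (-((D + 10) * Real.log N)) = (N : ℝ) ^ (-D) * ((N : ℝ) ^ 10)⁻¹ := by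
    rw [Real.rpow_def_of_pos hNpos, ← Real.rpow_natCast, Real.rpow_def_of_pos hNpos,
      ← Real.exp_neg, ← Real.exp_add]
    congr 1
    push_cast
    ring
  rw [hexp]
  have h160 : 160 * (N : ℝ) ^ 5 ≤ (N : ℝ) ^ 10 := by
    have h1 : (160 : ℝ) ≤ (N : ℝ) ^ 5 := by
      have h2 : (160 : ℝ) ≤ N := by
        have : 160 ≤ N := by omega
        exact_mod_cast this
      exact h2.trans (le_self_pow₀ hr.one_le_N (by norm_num))
    calc 160 * (N : ℝ) ^ 5 ≤ (N : ℝ) ^ 5 * (N : ℝ) ^ 5 := by gcongr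
      _ = (N : ℝ) ^ 10 := by ring
  calc 160 * (N : ℝ) ^ 5 * ((N : ℝ) ^ (-D) * ((N : ℝ) ^ 10)⁻¹)
      ≤ (N : ℝ) ^ 10 * ((N : ℝ) ^ (-D) * ((N : ℝ) ^ 10)⁻¹) := by gcongr
    _ = (N : ℝ) ^ (-D) := by field_simp
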